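/- Let $m,r\in\mathbb N$ be positive, let $p,q\in\mathbb N$ and $t_0\ge 0$. Consider $$y^{(r)}(t)=f\big(d(t),\mathbf T(y,\dots,y^{(r-1)})(t),u(t)\big),\qquad y|_{[0,t_0]}=y^0\in C^{r-1}([0,t_0],\mathbb R^m),$$ where for $t_0=0$ the initial condition means $(y,\dot y,\dots,y^{(r-1)})(0)=y^0\in\mathbb R^{rm}$, and assume that $(d,f,\mathbf T)$ belongs to the class $\mathcal N^{m,r}$, that is: - $d\in L^\infty([t_0,\infty),\mathbb R^p)$. - $\mathbf T:C([0,\infty),\mathbb R^{rm})\to L^\infty_{\rm loc}([t_0,\infty),\mathbb R^q)$ is *causal* (for all $t\ge t_0$, $y_1|_{[0,t]}=y_2|_{[0,t]}$ implies $\mathbf T(y_1)|_{[t_0,t]}=\mathbf T(y_2)|_{[t_0,t]}$); *locally Lipschitz* (for all $t\ge t_0$ and $y\in C([0,t],\mathbb R^{rm})$ there are $\Delta,\delta,c>0$ such that for all $y_1,y_2\in C([0,\infty),\mathbb R^{rm})$ with $y_1|_{[0,t]}=y_2|_{[0,t]}=y$ and $\|y_i(s)-y(t)\|<\delta$ for all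 $s\in[t,t+\Delta]$ and $i=1,2$, one has $\operatorname{ess\,sup}_{[t,t+\Delta]}\|\mathbf T(y_1)-\mathbf T(y_2)\|\le c\sup_{[t,t+\Delta]}\|y_1-y_2\|$); and *BIBO* (for all $c_0>0$ there is $c_1>0$ such that $\sup_{t\ge0}\|y(t)\|\le c_0$ implies $\operatorname{ess\,sup}_{t\ge t_0}\|\mathbf T(y)(t)\|\le c_1$). - $f\in C(\mathbb R^p\times\mathbb R^q\times\mathbb R^m,\mathbb R^m)$ has the *high-gain property*: there is $\nu\in(0,1)$ such that for all nonempty compact $K_p\subset\mathbb R^p$, $K_q\subset\mathbb R^q$ the function $\mathfrak h(s)=\min\{\langle v,f(\delta,z,-sv)\rangle:\delta\in K_p,\ z\in K_q,\ \nu\le\|v\|\le1\}$ satisfies $\sup_{s\in\mathbb R}\mathfrak h(s)=\infty$. Let $\psi\in W^{1,\infty}([0,\infty),\mathbb R)$ with $\inf_{t\ge0}\psi(t)>0$, and let $\alpha,\beta>0$ be such that $\dot\psi(t)\ge-\alpha\psi(t)+\beta$ for almost all $t\ge0$. Let $k\ge\alpha+2$. For $z=(z_1,\dots,z_r)\in\mathbb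 R^{rm}$ put $\sigma(z)=(z_2,\dots,z_r,0)$, $\xi_1(z)=z_1$ and $\xi_{i+1}(z)=\xi_i(\sigma(z))+k\,\xi_i(z)$ for $i=1,\dots,r-1$, and write $\chi(\zeta)=(\zeta,\dot\zeta,\dots,\zeta^{(r-1)})$. Let $N\in C([0,\infty),\mathbb R)$ be a surjection and $\gamma\in C([0,1),[1,\infty))$ a bijection. Let $y_{\rm ref}\in W^{r,\infty}([0,\infty),\mathbb R^m)$ satisfy $$\|\xi_1(\chi(y-y_{\rm ref})(t_0))\|<\psi(t_0),\qquad \|\xi_i(\chi(y-y_{\rm ref})(t_0))\|<\beta/\alpha\quad(i=2,\dots,r),$$ where $\chi(y)(t_0)$ is given by the initial data, and, if $r=1$, also $\|\xi_1(\chi(y-y_{\rm ref})(t_0))\|<\beta/\alpha$. Consider the closed loop with the controller $$e_r(t)=\xi_r(\chi(y-y_{\rm ref})(t)),\qquad u(t)=N\big(\gamma(\|\tfrac\alpha\beta e_r(t)\|^2)\big)\,e_r(t).$$ A *solution* is a function $x=\chi(y):[0,\omega)\to\mathbb R^{rm}$, $t_0<\omega\le\infty$, with the prescribed initial data on $[0,t_0]$,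 locally absolutely continuous on $[t_0,\omega)$, with $\|\tfrac\alpha\beta e_r(t)\|<1$ for all $t\in[t_0,\omega)$, and satisfying the differential equation almost everywhere on $[t_0,\omega)$; it is *maximal* if it has no proper right extension that is a solution. Then the closed loop has a solution, and every maximal solution has the following properties: 1. it is global, i.e. $\omega=\infty$; 2. the input $u$ is bounded on $[t_0,\infty)$; 3. if $\psi(t_0)\ge\beta/\alpha$, then the error $e=y-y_{\rm ref}$ stays in the funnel: $\|e(t)\|<\psi(t)$ for all $t\ge t_0$. -/

import Mathlib

open MeasureTheory Set
open scoped NNReal ENNReal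

noncomputable section

namespace FunnelControl

/-- Euclidean space of dimension `n`. -/
abbrev Vec (n : ℕ) : Type := EuclideanSpace ℝ (Fin n)

/-- The space `ℝ^{rm}` of tuples `(z_1, …, z_r)` of vectors of `ℝ^m`, with its Euclidean norm. The
component `z_i` is `z (i - 1)`. -/
abbrev State (r m : ℕ) : Type := PiLp 2 (fun _ : Fin r => Vec m)

/-! ### Sobolev spaces on the half-line -/

/-- `g` is a weak derivative of `f` on the half-line `(0, ∞)`. -/
def HasWeakDeriv {E : Type*} [NormedAddCommGroup E] [NormedSpace ℝ E] (f g : ℝ → E) : Prop :=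
  ∀ φ : ℝ → ℝ, ContDiff ℝ ((⊤ : ℕ∞) : WithTop ℕ∞) φ → HasCompactSupport φ →
    tsupport φ ⊆ Ioi 0 →
      ∫ t in Ioi (0 : ℝ), deriv φ t • f t = - ∫ t in Ioi (0 : ℝ), φ t • g t

/-- `Y 0` belongs to `W^{k,∞}([0,∞), E)` and `Y j` is its `j`-th weak derivative, for `j ≤ k`. As
usual the derivatives of order less than `k` stand for their continuous representatives, so that
their values at single points make sense. -/
structure IsSobolevJet {E : Type*} [NormedAddCommGroup E] [NormedSpace ℝ E]
    (k : ℕ) (Y : ℕ → ℝ → E) : Prop where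
  memLp : ∀ j ≤ k, MemLp (Y j) ∞ (volume.restrict (Ici (0 : ℝ)))
  hasWeakDeriv : ∀ j < k, HasWeakDeriv (Y j) (Y (j + 1))
  continuousOn : ∀ j < k, ContinuousOn (Y j) (Ici (0 : ℝ))

/-- `ψ` belongs to the class `𝒢` of funnel functions, with associated constants `α, β`. -/
def IsFunnel (α β : ℝ) (ψ : ℝ → ℝ) : Prop :=
  0 < α ∧ 0 < β ∧ (∃ c : ℝ, 0 < c ∧ ∀ t : ℝ, 0 ≤ t → c ≤ ψ t) ∧
    ∃ Y : ℕ → ℝ → ℝ, IsSobolevJet 1 Y ∧ Y 0 = ψ ∧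
      ∀ᵐ t ∂(volume.restrict (Ici (0 : ℝ))), -α * ψ t + β ≤ Y 1 t

/-! ### The system class -/

/-- The operator class `𝒯^{n,q}_{t₀}`, on functions with values in a normed space `X`. An element
of `L^∞_loc([t₀,∞), ℝ^q)` is given by a representative, so identities and bounds for it hold almost
everywhere. -/
structure IsAdmissibleOperator {X : Type*} [NormedAddCommGroup X] {q : ℕ} (t₀ : ℝ≥0)
    (T : C(ℝ≥0, X) → ℝ → Vec q) : Prop where
  locallyBounded : ∀ (y : C(ℝ≥0, X)) (τ : ℝ),
    MemLp (T y) ∞ (volume.restrict (Icc (t₀ : ℝ) τ))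
  causal : ∀ (y₁ y₂ : C(ℝ≥0, X)) (t : ℝ≥0), t₀ ≤ t → (∀ s ≤ t, y₁ s = y₂ s) →
    ∀ᵐ s ∂(volume.restrict (Icc (t₀ : ℝ) t)), T y₁ s = T y₂ s
  locallyLipschitz : ∀ (t : ℝ≥0), t₀ ≤ t → ∀ y : C(ℝ≥0, X),
    ∃ Δ : ℝ≥0, ∃ δ c : ℝ, 0 < Δ ∧ 0 < δ ∧ 0 < c ∧ ∀ y₁ y₂ : C(ℝ≥0, X),
      (∀ s ≤ t, y₁ s = y s) → (∀ s ≤ t, y₂ s = y s) →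
      (∀ s ∈ Icc t (t + Δ), ‖y₁ s - y t‖ < δ) → (∀ s ∈ Icc t (t + Δ), ‖y₂ s - y t‖ < δ) →
      ∀ᵐ s ∂(volume.restrict (Icc (t : ℝ) (t + Δ))),
        ‖T y₁ s - T y₂ s‖ ≤ c * sSup ((fun σ => ‖y₁ σ - y₂ σ‖) '' Icc t (t + Δ))
  bibo : ∀ c₀ : ℝ, 0 < c₀ → ∃ c₁ : ℝ, 0 < c₁ ∧ ∀ y : C(ℝ≥0, X), (∀ t, ‖y t‖ ≤ c₀) →
    ∀ᵐ t ∂(volume.restrict (Ici (t₀ : ℝ))), ‖T y t‖ ≤ c₁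

/-- The function `𝔥` of the high-gain property. (The infimum is a minimum for compact nonempty
`Kp`, `Kq`, continuous `f` and `m ≥ 1`.) -/
def highGainFun {p q m : ℕ} (f : Vec p × Vec q × Vec m → Vec m) (ν : ℝ)
    (Kp : Set (Vec p)) (Kq : Set (Vec q)) (s : ℝ) : ℝ :=
  sInf {a : ℝ | ∃ δ ∈ Kp, ∃ z ∈ Kq, ∃ v : Vec m, ν ≤ ‖v‖ ∧ ‖v‖ ≤ 1 ∧
    a = inner ℝ v (f (δ, z, -(s • v)))}

/-- The high-gain property: `sup 𝔥 = ∞` for all compact nonempty `Kp` and `Kq`. -/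
def HasHighGain {p q m : ℕ} (f : Vec p × Vec q × Vec m → Vec m) : Prop :=
  ∃ ν : ℝ, 0 < ν ∧ ν < 1 ∧ ∀ (Kp : Set (Vec p)) (Kq : Set (Vec q)),
    IsCompact Kp → IsCompact Kq → Kp.Nonempty → Kq.Nonempty →
      ¬ BddAbove (range (highGainFun f ν Kp Kq))

/-- `(d, f, T)` belongs to the system class `𝒩^{m,r}`. -/
structure MemSystemClass {m r p q : ℕ} (t₀ : ℝ≥0) (d : ℝ → Vec p)
    (f : Vec p × Vec q × Vec m → Vec m) (T : C(ℝ≥0, State r m) → ℝ → Vec q) : Prop where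
  disturbance : MemLp d ∞ (volume.restrict (Ici (t₀ : ℝ)))
  operator : IsAdmissibleOperator t₀ T
  continuous : Continuous f
  highGain : HasHighGain f

/-- Initial data: `x⁰ = (y⁰, ẏ⁰, …, (y⁰)^{(r-1)})` on `[0, t₀]` for a function
`y⁰ ∈ C^{r-1}([0,t₀], ℝ^m)`. If `t₀ = 0`, the differentiability requirement is void, and `x⁰(0)` is
an arbitrary vector of `ℝ^{rm}`. -/
structure IsInitialData {r m : ℕ} (t₀ : ℝ≥0) (x₀ : ℝ → State r m) : Prop where
  continuousOn : ContinuousOn x₀ (Icc 0 (t₀ : ℝ))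
  hasDeriv : ∀ (i : Fin r) (h : (i : ℕ) + 1 < r), ∀ t ∈ Icc 0 (t₀ : ℝ),
    HasDerivWithinAt (fun s => x₀ s i) (x₀ t ⟨(i : ℕ) + 1, h⟩) (Icc 0 (t₀ : ℝ)) t

/-- `x : [0, ω) → ℝ^{rm}` is a Carathéodory solution of
`y^{(r)}(t) = f(d(t), T(y, …, y^{(r-1)})(t), u(t))`, `y|_{[0,t₀]} = y⁰`, where `x₀` is the initial
data. Only the values of `x` on `[0, ω)` matter. By causality `T(x)` makes sense on `[t₀, τ]` for
each `τ < ω`: it is `T(X)` for any continuous `X` on `[0, ∞)` that agrees with `x` on `[0, τ]`. -/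
structure IsSystemSolution {m r p q : ℕ} (t₀ : ℝ≥0) (d : ℝ → Vec p)
    (f : Vec p × Vec q × Vec m → Vec m) (T : C(ℝ≥0, State r m) → ℝ → Vec q)
    (x₀ : ℝ → State r m) (u : ℝ → Vec m) (ω : EReal) (x : ℝ → State r m) : Prop where
  lt : ((t₀ : ℝ) : EReal) < ω
  initial : ∀ t ∈ Icc 0 (t₀ : ℝ), x t = x₀ t
  absolutelyContinuous : ∀ τ : ℝ, (t₀ : ℝ) ≤ τ → (τ : EReal) < ω →
    AbsolutelyContinuousOnInterval x t₀ τ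
  equation : ∀ τ : ℝ, (t₀ : ℝ) ≤ τ → (τ : EReal) < ω →
    ∃ X : C(ℝ≥0, State r m), (∀ s : ℝ≥0, (s : ℝ) ≤ τ → X s = x s) ∧
      ∀ᵐ t ∂(volume.restrict (Icc (t₀ : ℝ) τ)), ∀ i : Fin r,
        HasDerivAt (fun s => x s i)
          (if h : (i : ℕ) + 1 < r then x t ⟨(i : ℕ) + 1, h⟩ else f (d t, T X t, u t)) t

/-! ### The controller -/

/-- The left shift `σ(z_1, …, z_r) = (z_2, …, z_r, 0)`. -/
def leftShift {r m : ℕ} (z : State r m) : State r m :=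
  WithLp.toLp 2 (fun i : Fin r => if h : (i : ℕ) + 1 < r then z ⟨(i : ℕ) + 1, h⟩ else 0)

/-- The auxiliary error functions `ξ_i` for `i = 1, …, r` (with the dummy value `0` for `i = 0`). -/
def auxError {r m : ℕ} [NeZero r] (k : ℝ) : ℕ → State r m → Vec m
  | 0, _ => 0
  | 1, z => z 0
  | i + 2, z => auxError k (i + 1) (leftShift z) + k • auxError k (i + 1) z

/-- `χ(y)(t) = (y(t), ẏ(t), …, y^{(r-1)}(t))`, where `Y j` is the `j`-th derivative of `y`. -/
def jet {m : ℕ} (r : ℕ) (Y : ℕ → ℝ → Vec m) (t : ℝ) : State r m :=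
  WithLp.toLp 2 (fun i : Fin r => Y i t)

/-- The gain functions of the controller: `N : [0,∞) → ℝ` is a continuous surjection and
`γ : [0,1) → [1,∞)` is a continuous bijection. -/
structure IsGainPair (N γ : ℝ → ℝ) : Prop where
  continuousOn_N : ContinuousOn N (Ici 0)
  surjOn_N : SurjOn N (Ici 0) univ
  continuousOn_γ : ContinuousOn γ (Ico 0 1)
  bijOn_γ : BijOn γ (Ico 0 1) (Ici 1)

/-- The feedback `N(γ(‖(α/β) e_r‖²)) e_r`; it is defined where `‖(α/β) e_r‖ < 1`. -/
def feedback {m : ℕ} (N γ : ℝ → ℝ) (α β : ℝ) (er : Vec m) : Vec m :=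
  N (γ (‖(α / β) • er‖ ^ 2)) • er

/-- The control input `u(t) = N(γ(‖(α/β) e_r(t)‖²)) e_r(t)` with `e_r(t) = ξ_r(χ(y - y_ref)(t))`,
along `x = χ(y)`. -/
def controlInput {m r : ℕ} [NeZero r] (N γ : ℝ → ℝ) (α β k : ℝ) (yref : ℕ → ℝ → Vec m)
    (x : ℝ → State r m) (t : ℝ) : Vec m :=
  feedback N γ α β (auxError k r (x t - jet r yref t))

/-- `x : [0, ω) → ℝ^{rm}` is a solution of the closed loop of the system and the funnel controller:
the control law is defined on `[t₀, ω)`, and `x` solves the system with that input. -/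
def IsClosedLoopSolution {m r p q : ℕ} [NeZero r] (t₀ : ℝ≥0) (d : ℝ → Vec p)
    (f : Vec p × Vec q × Vec m → Vec m) (T : C(ℝ≥0, State r m) → ℝ → Vec q)
    (x₀ : ℝ → State r m) (N γ : ℝ → ℝ) (α β k : ℝ) (yref : ℕ → ℝ → Vec m)
    (ω : EReal) (x : ℝ → State r m) : Prop :=
  (∀ t : ℝ, (t₀ : ℝ) ≤ t → (t : EReal) < ω →
    ‖(α / β) • auxError k r (x t - jet r yref t)‖ < 1) ∧
  IsSystemSolution t₀ d f T x₀ (controlInput N γ α β k yref x) ω x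

/-- A closed-loop solution is maximal if no proper right extension of it is a solution. -/
def IsMaximalClosedLoopSolution {m r p q : ℕ} [NeZero r] (t₀ : ℝ≥0) (d : ℝ → Vec p)
    (f : Vec p × Vec q × Vec m → Vec m) (T : C(ℝ≥0, State r m) → ℝ → Vec q)
    (x₀ : ℝ → State r m) (N γ : ℝ → ℝ) (α β k : ℝ) (yref : ℕ → ℝ → Vec m)
    (ω : EReal) (x : ℝ → State r m) : Prop :=
  IsClosedLoopSolution t₀ d f T x₀ N γ α β k yref ω x ∧
  ¬ ∃ (ω' : EReal) (x' : ℝ → State r m), ω < ω' ∧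
    (∀ t : ℝ, 0 ≤ t → (t : EReal) < ω → x' t = x t) ∧
    IsClosedLoopSolution t₀ d f T x₀ N γ α β k yref ω' x'

end FunnelControl

end

/-! Write `E = x - jet r yref`. Along a solution the auxiliary errors satisfy `ξ_i' = ξ_{i+1} - k
ξ_i` for `i < r`, while `y^{(r)}` enters `ξ_r'` with coefficient one. The control law is defined
only while `‖ξ_r‖ < β/α`. Feeding this bound down the chain (`norm_auxError_le_of_chain`) gives
`‖ξ_i‖ ≤ β/α` for `i ≥ 2` and an exponential estimate for `ξ_1`. The `ξ_i` together are a
triangular, hence injective, linear function of the state, so `x` is bounded on its whole lifetime.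
By causality and the BIBO property `T x` is then bounded too, and every argument of `f` except the
input stays in a compact set.

The high-gain property then produces a barrier (`exists_gain_barrier`). Choose `s` so that `𝔥(s)`
dominates all bounded perturbations. Since `N ∘ γ` takes every value arbitrarily close to `1`, some
radius `κ < 1` realises the gain `s`. By compactness the feedback points inward on a thin shell just
inside that radius, so `‖(α/β) e_r‖` cannot climb to `κ` (`lt_of_barrier`,
`IsClosedLoopSolution.exists_norm_lt`). Hence the input is bounded and the solution is Lipschitz. If
its lifetime were finite, it would have a limit at the end and could be restarted there
(`IsClosedLoopSolution.exists_extension`), contradicting maximality.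

Local existence, both at `t₀` and at a restart time, is a Peano theorem for causal equations:
delayed approximations, Arzelà–Ascoli, and the local Lipschitz property of `T` to pass to the limit
(`exists_local_solution`).

For the funnel, Gronwall gives `ψ t - β/α ≥ exp(-α(t - t₀)) (ψ t₀ - β/α)`. As `k ≥ α` and `k ≥ 1`,
the estimate for `ξ_1` stays strictly below this whenever `ψ t₀ ≥ β/α`. -/

noncomputable section

namespace FunnelControl

open Filter Topology

/-! ### Differential inequalities for absolutely continuous functions. -/

section AbsolutelyContinuous

theorem absolutelyContinuous_lipschitz_comp {X Y : Type*} [PseudoMetricSpace X]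
    [PseudoMetricSpace Y] {L : X → Y} {K : ℝ≥0} (hL : LipschitzWith K L) {g : ℝ → X} {a b : ℝ}
    (hg : AbsolutelyContinuousOnInterval g a b) :
    AbsolutelyContinuousOnInterval (fun t => L (g t)) a b := by
  apply squeeze_zero (fun t ↦ ?_) (fun t ↦ ?_) (by simpa using Tendsto.const_mul (K : ℝ) hg)
  · exact Finset.sum_nonneg (fun i hi ↦ by positivity)
  · rw [Finset.mul_sum]
    gcongr
    exact hL.dist_le_mul _ _

theorem absolutelyContinuous_norm_sq {E : Type*} [SeminormedAddCommGroup E] {g : ℝ → E} {a b : ℝ}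
    (hg : AbsolutelyContinuousOnInterval g a b) :
    AbsolutelyContinuousOnInterval (fun t => ‖g t‖ ^ 2) a b := by
  have h := absolutelyContinuous_lipschitz_comp lipschitzWith_one_norm hg
  have h2 : (fun t => ‖g t‖ ^ 2) = (fun t => ‖g t‖) * fun t => ‖g t‖ := by
    ext t
    simp [sq]
  rw [h2]
  exact h.mul h

variable {E F : Type*} [NormedAddCommGroup E] [NormedSpace ℝ E] [NormedAddCommGroup F]
  [NormedSpace ℝ F] {a b : ℝ}

theorem absolutelyContinuous_clm_comp (L : E →L[ℝ] F) {g : ℝ → E}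
    (hg : AbsolutelyContinuousOnInterval g a b) :
    AbsolutelyContinuousOnInterval (fun t => L (g t)) a b :=
  absolutelyContinuous_lipschitz_comp L.lipschitz hg

theorem le_of_ae_deriv_nonpos {g : ℝ → ℝ} (hab : a ≤ b)
    (hg : AbsolutelyContinuousOnInterval g a b)
    (h : ∀ᵐ t ∂(volume.restrict (Icc a b)), ∃ g', HasDerivAt g g' t ∧ g' ≤ 0) : g b ≤ g a := by
  have h1 := hg.integral_deriv_eq_sub
  have h2 : ∫ x in a..b, deriv g x ≤ 0 := by
    rw [intervalIntegral.integral_of_le hab]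
    apply integral_nonpos_of_ae
    apply ae_restrict_of_ae_restrict_of_subset Ioc_subset_Icc_self
    filter_upwards [h] with t ht
    obtain ⟨g', h3, h4⟩ := ht
    simpa [h3.deriv] using h4
  linarith

/-- Pairing with a vector of norm at most one reduces the claim to monotonicity of the scalar
function `⟪v, g⟫ - B`. -/
theorem norm_sub_le_of_ae_norm_deriv_le {E : Type*} [NormedAddCommGroup E] [InnerProductSpace ℝ E]
    {g : ℝ → E} {B : ℝ → ℝ} (hab : a ≤ b) (hg : AbsolutelyContinuousOnInterval g a b)
    (hB : AbsolutelyContinuousOnInterval B a b)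
    (h : ∀ᵐ t ∂(volume.restrict (Icc a b)),
      ∃ g' B', HasDerivAt g g' t ∧ HasDerivAt B B' t ∧ ‖g'‖ ≤ B') :
    ‖g b - g a‖ ≤ B b - B a := by
  have key : ∀ v : E, ‖v‖ ≤ 1 → inner ℝ v (g b - g a) ≤ B b - B a := by
    intro v hv
    have h1 := le_of_ae_deriv_nonpos (g := fun t => innerSL ℝ v (g t) - B t) hab
      ((absolutelyContinuous_clm_comp (innerSL ℝ v) hg).sub hB) (by
        filter_upwards [h] with t ht
        obtain ⟨g', B', h1, h2, h3⟩ := ht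
        refine ⟨innerSL ℝ v g' - B', ((innerSL ℝ v).hasFDerivAt.comp_hasDerivAt t h1).sub h2, ?_⟩
        have h4 := real_inner_le_norm v g'
        have h5 : ‖v‖ * ‖g'‖ ≤ 1 * B' := by gcongr
        simp only [innerSL_apply_apply]
        linarith)
    simp only [innerSL_apply_apply] at h1
    rw [inner_sub_right]
    linarith
  rcases eq_or_ne (g b - g a) 0 with h0 | h0
  · have := key 0 (by simp)
    rw [h0, norm_zero]
    simpa using this
  · have h1 : ‖g b - g a‖ ≠ 0 := norm_ne_zero_iff.2 h0
    -- The unit vector in the direction of the increment makes the pairing equal to its norm.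
    have := key (‖g b - g a‖⁻¹ • (g b - g a)) (by simp [norm_smul, h1])
    rw [inner_smul_left, real_inner_self_eq_norm_sq] at this
    simpa [sq, h1] using this

/-- Variation of constants estimate for `g' = -k g + h`. -/
theorem norm_le_of_ae_hasDerivAt_decay {E : Type*} [NormedAddCommGroup E] [InnerProductSpace ℝ E]
    {g h : ℝ → E} {k c : ℝ} (hk : 0 < k) (hab : a ≤ b)
    (hg : AbsolutelyContinuousOnInterval g a b)
    (hd : ∀ᵐ t ∂(volume.restrict (Icc a b)), HasDerivAt g (h t - k • g t) t)
    (hh : ∀ t ∈ Icc a b, ‖h t‖ ≤ c) :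
    ‖g b‖ ≤ Real.exp (-(k * (b - a))) * ‖g a‖ + c / k * (1 - Real.exp (-(k * (b - a)))) := by
  have hexp : ∀ t, HasDerivAt (fun t => Real.exp (k * (t - a))) (Real.exp (k * (t - a)) * k) t := by
    intro t
    have := (((hasDerivAt_id t).sub_const a).const_mul k).exp
    simpa using this
  have hAC : AbsolutelyContinuousOnInterval (fun t => Real.exp (k * (t - a))) a b :=
    ContDiffOn.absolutelyContinuousOnInterval (by fun_prop)
  -- With the integrating factor the term `-k g` cancels, leaving a derivative bounded by `c exp(k(t
  -- - a))`, which is the derivative of `B`.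
  have h1 := norm_sub_le_of_ae_norm_deriv_le (g := fun t => Real.exp (k * (t - a)) • g t)
    (B := fun t => c / k * Real.exp (k * (t - a))) hab (hAC.smul hg) (hAC.const_mul _) (by
      filter_upwards [hd, ae_restrict_mem measurableSet_Icc] with t ht hmem
      refine ⟨_, _, (hexp t).smul ht, (hexp t).const_mul _, ?_⟩
      have : Real.exp (k * (t - a)) • (h t - k • g t) + (Real.exp (k * (t - a)) * k) • g t
        = Real.exp (k * (t - a)) • h t := by
        rw [smul_sub, smul_smul]; abel
      rw [this, norm_smul, Real.norm_eq_abs, abs_of_pos (Real.exp_pos _)]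
      have := mul_le_mul_of_nonneg_left (hh t hmem) (Real.exp_pos (k * (t - a))).le
      calc _ ≤ _ := this
        _ = _ := by field_simp)
  simp only [sub_self, mul_zero, Real.exp_zero, one_smul, mul_one] at h1
  set X := Real.exp (k * (b - a)) with hX
  have hXpos : 0 < X := Real.exp_pos _
  have h2 : X * ‖g b‖ ≤ ‖g a‖ + (c / k * X - c / k) := by
    have h3 : ‖X • g b‖ = X * ‖g b‖ := by
      rw [norm_smul, Real.norm_eq_abs, abs_of_pos hXpos]
    have h4 := norm_sub_norm_le (X • g b) (g a)
    linarith
  rw [Real.exp_neg, ← hX]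
  have : X⁻¹ * (X * ‖g b‖) ≤ X⁻¹ * (‖g a‖ + (c / k * X - c / k)) :=
    mul_le_mul_of_nonneg_left h2 (inv_pos.2 hXpos).le
  calc ‖g b‖ = X⁻¹ * (X * ‖g b‖) := by field_simp
    _ ≤ _ := this
    _ = _ := by field_simp

theorem lipschitzOnWith_Icc_union {E : Type*} [PseudoMetricSpace E] {g : ℝ → E} {K : ℝ≥0} {c : ℝ}
    (h1 : LipschitzOnWith K g (Icc a b)) (h2 : LipschitzOnWith K g (Icc b c)) :
    LipschitzOnWith K g (Icc a c) := by
  have key : ∀ x ∈ Icc a c, ∀ y ∈ Icc a c, x ≤ y → dist (g x) (g y) ≤ K * dist x y := by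
    intro x hx y hy hxy
    rcases le_total y b with hyb | hyb
    · exact h1.dist_le_mul x ⟨hx.1, hxy.trans hyb⟩ y ⟨hy.1, hyb⟩
    rcases le_total b x with hxb | hxb
    · exact h2.dist_le_mul x ⟨hxb, hx.2⟩ y ⟨hyb, hy.2⟩
    have e1 := h1.dist_le_mul x ⟨hx.1, hxb⟩ b ⟨hx.1.trans hxb, le_rfl⟩
    have e2 := h2.dist_le_mul b ⟨le_rfl, hyb.trans hy.2⟩ y ⟨hyb, hy.2⟩
    have e3 := dist_triangle (g x) (g b) (g y)
    have e4 : dist x y = dist x b + dist b y := by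
      rw [Real.dist_eq, Real.dist_eq, Real.dist_eq, abs_of_nonpos (by linarith),
        abs_of_nonpos (by linarith), abs_of_nonpos (by linarith)]
      ring
    rw [e4, mul_add]
    linarith
  refine LipschitzOnWith.of_dist_le_mul fun x hx y hy => ?_
  rcases le_total x y with h | h
  · exact key x hx y hy h
  · rw [dist_comm, dist_comm x]
    exact key y hy x hx h

end AbsolutelyContinuous

/-! ### From weak derivatives to Lipschitz functions with a.e. derivatives. -/

section WeakDeriv

variable {E : Type*} [NormedAddCommGroup E] [NormedSpace ℝ E]

/-- `deriv Φ` is a probability density on `[a, b]`, so the integral is an average of values of `f`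
within `ε` of `f a`. -/
theorem norm_integral_deriv_smul_sub_le [CompleteSpace E] {f : ℝ → E} {Φ : ℝ → ℝ} {a b ε : ℝ}
    (hab : a ≤ b) (hΦ : ContDiff ℝ 1 Φ) (hmono : Monotone Φ) (h0 : Φ a = 0) (h1 : Φ b = 1)
    (hf : ContinuousOn f (Icc a b)) (hε : ∀ x ∈ Icc a b, ‖f x - f a‖ ≤ ε) :
    ‖(∫ x in a..b, deriv Φ x • f x) - f a‖ ≤ ε := by
  have hcont : Continuous (deriv Φ) := hΦ.continuous_deriv le_rfl
  have hI : ∫ x in a..b, deriv Φ x = 1 := by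
    rw [intervalIntegral.integral_deriv_eq_sub (fun x _ => (hΦ.differentiable (by simp)).differentiableAt)
      (hcont.intervalIntegrable _ _), h0, h1]
    simp
  have hint : IntervalIntegrable (fun x => deriv Φ x • f x) volume a b := by
    apply ContinuousOn.intervalIntegrable
    rw [uIcc_of_le hab]
    exact hcont.continuousOn.smul hf
  have h2 : (∫ x in a..b, deriv Φ x • f x) - f a = ∫ x in a..b, deriv Φ x • (f x - f a) := by
    simp_rw [smul_sub]
    rw [intervalIntegral.integral_sub hint (Continuous.intervalIntegrable (u := fun x => deriv Φ x • f a) (by fun_prop) _ _),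
      intervalIntegral.integral_smul_const, hI, one_smul]
  rw [h2]
  have h3 := intervalIntegral.norm_integral_le_of_norm_le (f := fun x => deriv Φ x • (f x - f a))
    (g := fun x => deriv Φ x * ε) (μ := volume) hab (by
      filter_upwards with x hx
      rw [norm_smul, Real.norm_eq_abs, abs_of_nonneg hmono.deriv_nonneg]
      exact mul_le_mul_of_nonneg_left (hε x ⟨hx.1.le, hx.2⟩) hmono.deriv_nonneg)
    ((hcont.mul continuous_const).intervalIntegrable _ _)
  rwa [intervalIntegral.integral_mul_const, hI, one_mul] at h3

/-- A smooth step from `0` on `(-∞, s]` to `1` on `[s + 1/(n+1), ∞)`. -/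
def smoothStep (s : ℝ) (n : ℕ) (x : ℝ) : ℝ := Real.smoothTransition ((n + 1) * (x - s))

theorem contDiff_smoothStep (s : ℝ) (n : ℕ) : ContDiff ℝ ((⊤ : ℕ∞) : WithTop ℕ∞) (smoothStep s n) :=
  Real.smoothTransition.contDiff.comp (by fun_prop)

theorem monotone_smoothStep (s : ℝ) (n : ℕ) : Monotone (smoothStep s n) := by
  intro x y hxy
  apply Real.smoothTransition.monotone
  gcongr

theorem smoothStep_of_le {s x : ℝ} (n : ℕ) (h : x ≤ s) : smoothStep s n x = 0 :=
  Real.smoothTransition.zero_of_nonpos (mul_nonpos_of_nonneg_of_nonpos (by positivity) (by linarith))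

theorem smoothStep_of_ge {s x : ℝ} (n : ℕ) (h : s + 1 / (n + 1) ≤ x) : smoothStep s n x = 1 := by
  apply Real.smoothTransition.one_of_one_le
  have : (1 : ℝ) / (n + 1) ≤ x - s := by linarith
  rw [div_le_iff₀ (by positivity)] at this
  linarith

/-- The derivatives of the steps form an approximate identity carried by `[s, s + 1/(n+1)]`. -/
theorem tendsto_integral_deriv_smoothStep [CompleteSpace E] {f : ℝ → E} {s A B : ℝ}
    (hA : A ≤ s) (hB : s + 1 ≤ B) (hf : ContinuousOn f (Icc A B)) :
    Tendsto (fun n => ∫ x in A..B, deriv (smoothStep s n) x • f x) atTop (𝓝 (f s)) := by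
  have hderivcont : ∀ n, Continuous (deriv (smoothStep s n)) := fun n =>
    (contDiff_smoothStep s n).continuous_deriv (by simp)
  rw [Metric.tendsto_atTop]
  intro ε hε
  have hfs : ContinuousWithinAt f (Icc A B) s := hf s ⟨hA, by linarith⟩
  obtain ⟨δ, hδ, hfδ⟩ := Metric.continuousWithinAt_iff.1 hfs (ε / 2) (by positivity)
  obtain ⟨M, hM⟩ := exists_nat_one_div_lt hδ
  refine ⟨M, fun n hn => ?_⟩
  have hn1 : (1 : ℝ) / (n + 1) ≤ 1 / (M + 1) := by gcongr
  have hn2 : (0 : ℝ) < 1 / (n + 1) := by positivity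
  have hn3 : (1 : ℝ) / (n + 1) ≤ 1 := by
    rw [div_le_iff₀ (by positivity)]
    have : (0 : ℝ) ≤ n := by positivity
    linarith
  have hint : ∀ u ∈ Icc A B, ∀ v ∈ Icc A B,
      IntervalIntegrable (fun x => deriv (smoothStep s n) x • f x) volume u v := by
    intro u hu v hv
    apply ContinuousOn.intervalIntegrable
    exact (hderivcont n).continuousOn.smul (hf.mono (ordConnected_Icc.uIcc_subset hu hv))
  have hsm : s ∈ Icc A B := ⟨hA, by linarith⟩
  have hsn : s + 1 / (n + 1) ∈ Icc A B := ⟨by linarith, by linarith⟩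
  have hAm : A ∈ Icc A B := ⟨le_rfl, by linarith⟩
  have hBm : B ∈ Icc A B := ⟨by linarith, le_rfl⟩
  have z1 : ∫ x in A..s, deriv (smoothStep s n) x • f x = 0 := by
    rw [intervalIntegral.integral_of_le hA, integral_Ioc_eq_integral_Ioo]
    apply setIntegral_eq_zero_of_forall_eq_zero
    intro x hx
    have : smoothStep s n =ᶠ[𝓝 x] fun _ => 0 := by
      filter_upwards [Iio_mem_nhds hx.2] with y hy using smoothStep_of_le n (le_of_lt hy)
    rw [this.deriv_eq]; simp
  have z2 : ∫ x in (s + 1 / (n + 1))..B, deriv (smoothStep s n) x • f x = 0 := by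
    rw [intervalIntegral.integral_of_le (by linarith)]
    apply setIntegral_eq_zero_of_forall_eq_zero
    intro x hx
    have : smoothStep s n =ᶠ[𝓝 x] fun _ => 1 := by
      filter_upwards [Ioi_mem_nhds hx.1] with y hy using smoothStep_of_ge n (le_of_lt hy)
    rw [this.deriv_eq]; simp
  have hsplit : ∫ x in A..B, deriv (smoothStep s n) x • f x =
      ∫ x in s..(s + 1 / (n + 1)), deriv (smoothStep s n) x • f x := by
    rw [← intervalIntegral.integral_add_adjacent_intervals (hint A hAm s hsm) (hint s hsm B hBm),
      ← intervalIntegral.integral_add_adjacent_intervals (hint s hsm _ hsn) (hint _ hsn B hBm),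
      z1, z2, zero_add, add_zero]
  rw [hsplit, dist_eq_norm]
  refine lt_of_le_of_lt (norm_integral_deriv_smul_sub_le (ε := ε / 2) (by linarith)
    ((contDiff_smoothStep s n).of_le (by simp)) (monotone_smoothStep s n) (smoothStep_of_le n le_rfl)
    (smoothStep_of_ge n le_rfl) (hf.mono (Icc_subset_Icc hA hsn.2)) ?_) (by linarith)
  intro x hx
  rw [← dist_eq_norm]
  refine (hfδ ⟨hA.trans hx.1, hx.2.trans hsn.2⟩ ?_).le
  rw [Real.dist_eq, abs_of_nonneg (by linarith [hx.1])]
  linarith [hx.2]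

theorem HasWeakDeriv.integral_eq_sub_of_pos [CompleteSpace E] {f g : ℝ → E}
    (h : HasWeakDeriv f g) (hf : ContinuousOn f (Ici 0))
    (hg : MemLp g ∞ (volume.restrict (Ici (0 : ℝ)))) {s t : ℝ} (hs : 0 < s) (hst : s ≤ t) :
    ∫ x in s..t, g x = f t - f s := by
  -- These test functions converge pointwise to the indicator of `(s, t]`. The left side of the weak
  -- identity tends to `f s - f t`, the right side to minus the integral of `g`.
  set φ : ℕ → ℝ → ℝ := fun n x => smoothStep s n x - smoothStep t n x with hφ
  have hφ0 : ∀ n x, x ∉ Ioc s (t + 1) → φ n x = 0 := by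
    intro n x hx
    have hn3 : (1 : ℝ) / (n + 1) ≤ 1 := by
      rw [div_le_iff₀ (by positivity)]
      have : (0 : ℝ) ≤ n := by positivity
      linarith
    rcases le_or_gt x s with h1 | h1
    · simp [hφ, smoothStep_of_le n h1, smoothStep_of_le n (h1.trans hst)]
    · have h2 : t + 1 < x := by
        by_contra h3
        exact hx ⟨h1, not_lt.1 h3⟩
      simp [hφ, smoothStep_of_ge n (show s + 1 / (n + 1) ≤ x by linarith),
        smoothStep_of_ge n (show t + 1 / (n + 1) ≤ x by linarith)]
  have hφsub : ∀ n, tsupport (φ n) ⊆ Icc s (t + 1) := by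
    intro n
    apply closure_minimal _ isClosed_Icc
    intro x hx
    by_contra h2
    exact hx (hφ0 n x fun h3 => h2 (Ioc_subset_Icc_self h3))
  have hφd : ∀ n, ContDiff ℝ ((⊤ : ℕ∞) : WithTop ℕ∞) (φ n) := fun n =>
    (contDiff_smoothStep s n).sub (contDiff_smoothStep t n)
  have hderiv0 : ∀ n x, x ∉ Icc s (t + 1) → deriv (φ n) x = 0 := by
    intro n x hx
    by_contra h2
    exact hx (hφsub n (support_deriv_subset h2))
  have hsubIoi : Ioc (s / 2) (t + 1) ⊆ Ioi (0 : ℝ) := fun x hx => by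
    have := hx.1
    simp only [mem_Ioi]; linarith
  have hcont : ContinuousOn f (Icc (s / 2) (t + 1)) :=
    hf.mono fun x hx => by simp only [mem_Ici]; linarith [hx.1]
  have hle : s / 2 ≤ t + 1 := by linarith
  have e1 : ∀ n, (∫ x in (s / 2)..(t + 1), deriv (smoothStep s n) x • f x) -
      (∫ x in (s / 2)..(t + 1), deriv (smoothStep t n) x • f x)
      = - ∫ x in Ioc s (t + 1), φ n x • g x := by
    intro n
    have h1 := h (φ n) (hφd n) (HasCompactSupport.of_support_subset_isCompact isCompact_Icc
      ((subset_tsupport _).trans (hφsub n))) ((hφsub n).trans fun x hx => lt_of_lt_of_le hs hx.1)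
    rw [setIntegral_eq_of_subset_of_forall_sdiff_eq_zero measurableSet_Ioi hsubIoi (by
        intro x hx
        rcases eq_or_ne (deriv (φ n) x) 0 with h0 | h0
        · rw [h0, zero_smul]
        · exfalso
          have h3 := not_imp_comm.1 (hderiv0 n x) h0
          exact hx.2 ⟨by linarith [h3.1], h3.2⟩),
      setIntegral_eq_of_subset_of_forall_sdiff_eq_zero (s := Ioc s (t + 1)) measurableSet_Ioi
        (fun x hx => hs.trans hx.1) (by
        intro x hx
        rw [hφ0 n x hx.2, zero_smul])] at h1
    rw [← h1, intervalIntegral.integral_of_le hle, intervalIntegral.integral_of_le hle,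
      ← integral_sub]
    · refine integral_congr_ae (Eventually.of_forall fun x => ?_)
      have : deriv (φ n) x = deriv (smoothStep s n) x - deriv (smoothStep t n) x := by
        apply deriv_fun_sub
        · exact ((contDiff_smoothStep s n).differentiable (by simp)).differentiableAt
        · exact ((contDiff_smoothStep t n).differentiable (by simp)).differentiableAt
      simp only [this, sub_smul]
    all_goals
      apply IntegrableOn.mono_set _ Ioc_subset_Icc_self
      apply ContinuousOn.integrableOn_compact isCompact_Icc
      refine Continuous.continuousOn ?_ |>.smul hcont
      exact (contDiff_smoothStep _ n).continuous_deriv (by simp)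
  have l1 := (tendsto_integral_deriv_smoothStep (s := s) (by linarith) (by linarith) hcont).sub
    (tendsto_integral_deriv_smoothStep (s := t) (by linarith) (by linarith) hcont)
  have hgint : Integrable g (volume.restrict (Ioc s (t + 1))) :=
    (hg.mono_measure (Measure.restrict_mono (fun x hx => by
      simp only [mem_Ici]; linarith [hx.1]) le_rfl)).integrable (by simp)
  have l2 : Tendsto (fun n => - ∫ x in Ioc s (t + 1), φ n x • g x) atTop
      (𝓝 (- ∫ x in Ioc s (t + 1), (Ioc s t).indicator g x)) := by
    refine (tendsto_integral_of_dominated_convergence (fun x => ‖g x‖) ?_ hgint.norm ?_ ?_).neg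
    · intro n
      exact (hφd n).continuous.aestronglyMeasurable.smul hgint.1
    · intro n
      refine Eventually.of_forall fun x => ?_
      rw [norm_smul]
      refine mul_le_of_le_one_left (norm_nonneg _) ?_
      rw [Real.norm_eq_abs, abs_le]
      have := Real.smoothTransition.nonneg ((n + 1) * (x - s))
      have := Real.smoothTransition.nonneg ((n + 1) * (x - t))
      have := Real.smoothTransition.le_one ((n + 1) * (x - s))
      have := Real.smoothTransition.le_one ((n + 1) * (x - t))
      simp only [hφ, smoothStep]
      constructor <;> linarith
    · filter_upwards [ae_restrict_mem measurableSet_Ioc] with x hx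
      have ev : ∀ u, u < x → ∀ᶠ n : ℕ in atTop, smoothStep u n x = 1 := by
        intro u hu
        have h0 := (tendsto_one_div_add_atTop_nhds_zero_nat (𝕜 := ℝ)).eventually
          (gt_mem_nhds (sub_pos.2 hu))
        filter_upwards [h0] with n hn
        exact smoothStep_of_ge n (by linarith)
      rcases le_or_gt x t with hxt | hxt
      · rw [indicator_of_mem (show x ∈ Ioc s t from ⟨hx.1, hxt⟩)]
        refine tendsto_const_nhds.congr' ?_
        filter_upwards [ev s hx.1] with n hn
        simp [hφ, hn, smoothStep_of_le n hxt]
      · rw [indicator_of_notMem (fun h => absurd h.2 (not_le.2 hxt))]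
        refine tendsto_const_nhds.congr' ?_
        filter_upwards [ev s hx.1, ev t hxt] with n hn hn'
        simp [hφ, hn, hn']
  have := tendsto_nhds_unique (l1.congr e1) l2
  rw [setIntegral_indicator measurableSet_Ioc, inter_eq_self_of_subset_right
    (Ioc_subset_Ioc_right (by linarith)), ← intervalIntegral.integral_of_le hst] at this
  rw [← neg_sub, this, neg_neg]

/-- Test functions vanish near `0`, so the case `s = 0` is reached as a limit from the right, both
sides being continuous in `s`. -/
theorem HasWeakDeriv.integral_eq_sub [CompleteSpace E] {f g : ℝ → E}
    (h : HasWeakDeriv f g) (hf : ContinuousOn f (Ici 0))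
    (hg : MemLp g ∞ (volume.restrict (Ici (0 : ℝ)))) {s t : ℝ} (hs : 0 ≤ s) (hst : s ≤ t) :
    ∫ x in s..t, g x = f t - f s := by
  rcases hs.eq_or_lt with rfl | hs
  swap
  · exact h.integral_eq_sub_of_pos hf hg hs hst
  rcases hst.eq_or_lt with rfl | hst
  · simp
  have hint : IntegrableOn g (Icc 0 t) :=
    (hg.mono_measure (Measure.restrict_mono Icc_subset_Ici_self le_rfl)).integrable (by simp)
  have hc := intervalIntegral.continuousOn_primitive_interval' (μ := volume) (f := g) (a := t)
    (b₁ := 0) (b₂ := t) (by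
      rw [intervalIntegrable_iff_integrableOn_Ioc_of_le hst.le]
      exact hint.mono_set Ioc_subset_Icc_self) (by simp)
  rw [uIcc_of_le hst.le] at hc
  have h0 := hc 0 ⟨le_rfl, hst.le⟩
  have h1 : ContinuousWithinAt (fun s => f s - f t) (Icc 0 t) 0 :=
    ((hf.mono Icc_subset_Ici_self) 0 ⟨le_rfl, hst.le⟩).sub continuousWithinAt_const
  have hne : (𝓝[Ioc 0 t] (0 : ℝ)).NeBot := by
    rw [nhdsWithin_Ioc_eq_nhdsGT hst]; infer_instance
  have := tendsto_nhds_unique_of_eventuallyEq (h0.mono Ioc_subset_Icc_self)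
    (h1.mono Ioc_subset_Icc_self) (by
      filter_upwards [self_mem_nhdsWithin] with x hx
      rw [intervalIntegral.integral_symm, h.integral_eq_sub_of_pos hf hg hx.1 hx.2]
      abel)
  beta_reduce at this
  rw [intervalIntegral.integral_symm, this]
  abel

theorem ae_norm_le_of_memLp_top {F : Type*} [NormedAddCommGroup F] {g : ℝ → F} {μ : Measure ℝ}
    (hg : MemLp g ∞ μ) : ∃ C : ℝ, 0 < C ∧ ∀ᵐ t ∂μ, ‖g t‖ ≤ C := by
  refine ⟨(eLpNorm g ∞ μ).toReal + 1, by positivity, ?_⟩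
  have h1 := ae_le_eLpNormEssSup (f := g) (μ := μ)
  filter_upwards [h1] with t ht
  have h2 : eLpNormEssSup g μ = eLpNorm g ∞ μ := eLpNorm_exponent_top.symm
  rw [h2, ← ofReal_norm] at ht
  have := (ENNReal.ofReal_le_iff_le_toReal hg.2.ne).1 ht
  linarith

/-- A continuous function on `[0, ∞)` with an `L^∞` weak derivative is Lipschitz. -/
theorem HasWeakDeriv.exists_lipschitzOnWith [CompleteSpace E] {f g : ℝ → E}
    (h : HasWeakDeriv f g) (hf : ContinuousOn f (Ici 0))
    (hg : MemLp g ∞ (volume.restrict (Ici (0 : ℝ)))) :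
    ∃ K : ℝ≥0, LipschitzOnWith K f (Ici 0) := by
  obtain ⟨C, hC, hgC⟩ := ae_norm_le_of_memLp_top hg
  refine ⟨⟨C, hC.le⟩, LipschitzOnWith.of_dist_le_mul ?_⟩
  have key : ∀ x : ℝ, 0 ≤ x → ∀ y, x ≤ y → dist (f x) (f y) ≤ C * dist x y := by
    intro x hx y hxy
    rw [dist_comm, dist_eq_norm, ← h.integral_eq_sub hf hg hx hxy, dist_comm, Real.dist_eq]
    refine intervalIntegral.norm_integral_le_of_norm_le_const_ae ?_
    rw [ae_restrict_iff' measurableSet_Ici] at hgC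
    filter_upwards [hgC] with t ht hmem
    rw [uIoc_of_le hxy] at hmem
    exact ht (hx.trans hmem.1.le)
  intro x hx y hy
  rcases le_total x y with hxy | hxy
  · exact key x hx y hxy
  · rw [dist_comm, dist_comm x]
    exact key y hy x hxy

theorem HasWeakDeriv.absolutelyContinuous [CompleteSpace E] {f g : ℝ → E}
    (h : HasWeakDeriv f g) (hf : ContinuousOn f (Ici 0))
    (hg : MemLp g ∞ (volume.restrict (Ici (0 : ℝ)))) {a b : ℝ} (ha : 0 ≤ a) (hab : a ≤ b) :
    AbsolutelyContinuousOnInterval f a b := by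
  obtain ⟨K, hK⟩ := h.exists_lipschitzOnWith hf hg
  refine (hK.mono ?_).absolutelyContinuousOnInterval
  rw [uIcc_of_le hab]
  exact fun x hx => ha.trans hx.1

theorem HasWeakDeriv.ae_hasDerivAt [CompleteSpace E] {f g : ℝ → E}
    (h : HasWeakDeriv f g) (hf : ContinuousOn f (Ici 0))
    (hg : MemLp g ∞ (volume.restrict (Ici (0 : ℝ)))) {a b : ℝ} (ha : 0 ≤ a) (hab : a ≤ b) :
    ∀ᵐ t ∂(volume.restrict (Icc a b)), HasDerivAt f (g t) t := by
  have hint : IntervalIntegrable g volume a b := by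
    rw [intervalIntegrable_iff_integrableOn_Ioc_of_le hab]
    exact (hg.mono_measure (Measure.restrict_mono (fun x hx => ha.trans hx.1.le)
      le_rfl)).integrable (by simp)
  rw [ae_restrict_iff' measurableSet_Icc]
  -- The integral representation of `f` is used only on `[a, b]`; a two-sided derivative needs an
  -- interior point.
  have h1 : ∀ᵐ x : ℝ, x ≠ a := by simp [ae_iff, measure_singleton]
  have h2 : ∀ᵐ x : ℝ, x ≠ b := by simp [ae_iff, measure_singleton]
  filter_upwards [hint.ae_hasDerivAt_integral, h1, h2] with t ht hta htb hmem
  rw [uIcc_of_le hab] at ht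
  have h3 := (ht hmem a ⟨le_rfl, hab⟩).const_add (f a)
  refine h3.congr_of_eventuallyEq ?_
  filter_upwards [Ioo_mem_nhds (lt_of_le_of_ne hmem.1 hta.symm) (lt_of_le_of_ne hmem.2 htb)]
    with x hx
  rw [h.integral_eq_sub hf hg ha hx.1.le]
  abel

/-- If the norm exceeded the essential bound at one point, it would do so on an interval to the
right of it, which has positive measure. One-sided intervals cover the endpoint `0` as well. -/
theorem exists_norm_le_of_continuousOn_memLp_top {F : Type*} [NormedAddCommGroup F] {f : ℝ → F}
    (hf : ContinuousOn f (Ici 0)) (hg : MemLp f ∞ (volume.restrict (Ici (0 : ℝ)))) :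
    ∃ C : ℝ, ∀ t, 0 ≤ t → ‖f t‖ ≤ C := by
  obtain ⟨C, hC, hgC⟩ := ae_norm_le_of_memLp_top hg
  refine ⟨C, fun t ht => ?_⟩
  by_contra hlt
  push Not at hlt
  have h1 : {x | C < ‖f x‖} ∈ 𝓝[Ici 0] t := (hf t ht).norm.eventually (lt_mem_nhds hlt)
  obtain ⟨u, hu, hsub⟩ := mem_nhdsGE_iff_exists_Ico_subset.1
    (nhdsWithin_mono t (Ici_subset_Ici.2 ht) h1)
  rw [ae_iff, Measure.restrict_apply₀' measurableSet_Ici.nullMeasurableSet] at hgC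
  have h2 : Ico t u ⊆ {x | ¬ ‖f x‖ ≤ C} ∩ Ici 0 := fun x hx =>
    ⟨not_le.2 (hsub hx), ht.trans hx.1⟩
  have h3 := measure_mono_null h2 hgC
  rw [Real.volume_Ico, ENNReal.ofReal_eq_zero] at h3
  have : t < u := hu
  linarith

end WeakDeriv

/-! ### Linear algebra of the auxiliary errors. -/

section AuxError

variable {r m : ℕ}

/-- `(z_2, …, z_r, v)`. -/
def shiftAppend (z : State r m) (v : Vec m) : State r m :=
  WithLp.toLp 2 (fun i : Fin r => if h : (i : ℕ) + 1 < r then z ⟨(i : ℕ) + 1, h⟩ else v)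

theorem leftShift_add (z w : State r m) : leftShift (z + w) = leftShift z + leftShift w := by
  ext i : 1
  by_cases h : (i : ℕ) + 1 < r <;> simp [leftShift, h]

theorem leftShift_smul (c : ℝ) (z : State r m) : leftShift (c • z) = c • leftShift z := by
  ext i : 1
  by_cases h : (i : ℕ) + 1 < r <;> simp [leftShift, h]

theorem shiftAppend_eq (z : State r m) (v : Vec m) :
    shiftAppend z v = leftShift z + shiftAppend 0 v := by
  ext i : 1
  by_cases h : (i : ℕ) + 1 < r <;> simp [leftShift, shiftAppend, h]

theorem shiftAppend_sub (z z' : State r m) (v v' : Vec m) :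
    shiftAppend z v - shiftAppend z' v' = shiftAppend (z - z') (v - v') := by
  ext i : 1
  by_cases h : (i : ℕ) + 1 < r <;> simp [shiftAppend, h]

theorem continuous_shiftAppend :
    Continuous fun p : State r m × Vec m => shiftAppend p.1 p.2 := by
  unfold shiftAppend
  refine (PiLp.continuous_toLp 2 _).comp (continuous_pi fun i => ?_)
  by_cases h : (i : ℕ) + 1 < r <;> simp only [h, dite_true, dite_false] <;> fun_prop

theorem continuousSMul_of_normedSpace {E : Type*} [SeminormedAddCommGroup E] [NormedSpace ℝ E] :
    ContinuousSMul ℝ E := inferInstance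

/-- A shortcut: the default search for this instance is very slow. -/
instance instContinuousSMulState : ContinuousSMul ℝ (State r m) := continuousSMul_of_normedSpace

theorem hasDerivAt_piLp_iff {ι : Type*} [Fintype ι] {F : Type*} [NormedAddCommGroup F]
    [NormedSpace ℝ F] {x : ℝ → PiLp 2 (fun _ : ι => F)} {x' : PiLp 2 (fun _ : ι => F)} {t : ℝ} :
    HasDerivAt x x' t ↔ ∀ i, HasDerivAt (fun s => x s i) (x' i) t := by
  constructor
  · intro h i
    exact (PiLp.proj (𝕜 := ℝ) 2 (fun _ : ι => F) i).hasFDerivAt.comp_hasDerivAt t h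
  · intro h
    have h1 : HasDerivAt (fun s => (fun i => x s i)) (fun i => x' i) t := hasDerivAt_pi.2 h
    exact (PiLp.hasFDerivAt_toLp (𝕜 := ℝ) 2 _).comp_hasDerivAt t h1

theorem hasDerivAt_state_iff {x : ℝ → State r m} {x' : State r m} {t : ℝ} :
    HasDerivAt x x' t ↔ ∀ i : Fin r, HasDerivAt (fun s => x s i) (x' i) t := hasDerivAt_piLp_iff

variable [NeZero r]

theorem auxError_add (k : ℝ) (i : ℕ) (z w : State r m) :
    auxError k i (z + w) = auxError k i z + auxError k i w := by
  induction i using Nat.strong_induction_on generalizing z w with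
  | _ i ih =>
    match i, ih with
    | 0, _ => simp [auxError]
    | 1, _ => simp [auxError]
    | i + 2, ih =>
      simp only [auxError]
      rw [leftShift_add, ih (i + 1) (by omega), ih (i + 1) (by omega), smul_add]
      abel

theorem auxError_smul (k : ℝ) (i : ℕ) (c : ℝ) (z : State r m) :
    auxError k i (c • z) = c • auxError k i z := by
  induction i using Nat.strong_induction_on generalizing z with
  | _ i ih =>
    match i, ih with
    | 0, _ => simp [auxError]
    | 1, _ => simp [auxError]
    | i + 2, ih =>
      simp only [auxError]
      rw [leftShift_smul, ih (i + 1) (by omega), ih (i + 1) (by omega), smul_add, smul_comm c k]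

/-- `auxError` as a continuous linear map. -/
def auxErrorCLM (r m : ℕ) [NeZero r] (k : ℝ) (i : ℕ) : State r m →L[ℝ] Vec m :=
  LinearMap.toContinuousLinearMap
    { toFun := auxError k i
      map_add' := auxError_add k i
      map_smul' := fun c z => auxError_smul k i c z }

@[simp] theorem auxErrorCLM_apply (k : ℝ) (i : ℕ) (z : State r m) :
    auxErrorCLM r m k i z = auxError k i z := rfl

/-- The system is triangular with unit diagonal: `ξ_{i+1}(z)` is the component of index `i` plus a
combination of earlier ones. -/
theorem auxError_succ_of_forall_lt (k : ℝ) (i : ℕ) (hi : i < r) (z : State r m)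
    (hz : ∀ j : Fin r, (j : ℕ) < i → z j = 0) : auxError k (i + 1) z = z ⟨i, hi⟩ := by
  induction i generalizing z with
  | zero => rfl
  | succ i ih =>
    simp only [auxError]
    rw [ih (by omega) z (fun j hj => hz j (by omega)), hz ⟨i, _⟩ (by simp), smul_zero, add_zero,
      ih (by omega)]
    · simp [leftShift, hi]
    · intro j hj
      simp only [leftShift, show (j : ℕ) + 1 < r by omega, dite_true]
      exact hz _ (by simpa using hj)

/-- Since `shiftAppend x y^{(r)}` is the derivative of the state, this is the chain `ξ_{i+1}' =
ξ_{i+2} - k ξ_{i+1}`. The appended vector sits in the last slot, which `ξ_{i+1}` does not see when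
`i + 1 < r`. -/
theorem auxError_shiftAppend_of_lt (k : ℝ) {i : ℕ} (hi : i + 1 < r) (z : State r m) (v : Vec m) :
    auxError k (i + 1) (shiftAppend z v) = auxError k (i + 2) z - k • auxError k (i + 1) z := by
  have h : auxError k (i + 1) (shiftAppend (0 : State r m) v) = 0 := by
    rw [auxError_succ_of_forall_lt k i (by omega)]
    · simp [shiftAppend, hi]
    · intro j hj
      simp [shiftAppend, show (j : ℕ) + 1 < r by omega]
  rw [shiftAppend_eq, auxError_add, h]
  simp [auxError]

/-- The last slot enters `ξ_r` with coefficient one, so the input acts directly on `e_r'`. -/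
theorem auxError_shiftAppend_self (k : ℝ) (z : State r m) (v : Vec m) :
    auxError k r (shiftAppend z v) = auxError k r (leftShift z) + v := by
  obtain ⟨n, hn⟩ : ∃ n, r = n + 1 := Nat.exists_eq_succ_of_ne_zero (NeZero.ne r)
  have h : auxError k r (shiftAppend (0 : State r m) v) = v := by
    have := auxError_succ_of_forall_lt (r := r) k n (by omega) (shiftAppend (0 : State r m) v) (by
      intro j hj
      simp [shiftAppend, show (j : ℕ) + 1 < r by omega])
    rw [← hn] at this
    rw [this]
    simp [shiftAppend, ← hn]
  rw [shiftAppend_eq, auxError_add, h]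

theorem eq_zero_of_auxError_eq_zero (k : ℝ) (z : State r m)
    (h : ∀ i < r, auxError k (i + 1) z = 0) : z = 0 := by
  have key : ∀ n, ∀ hn : n < r, z ⟨n, hn⟩ = 0 := by
    intro n
    induction n using Nat.strong_induction_on with
    | _ n ih =>
      intro hn
      rw [← auxError_succ_of_forall_lt k n hn z (fun j hj => ih j hj j.2)]
      exact h n hn
  ext i : 1
  exact key i i.2

/-- An injective linear map on a finite-dimensional space is bounded below. -/
theorem exists_norm_le_of_auxError_le (r m : ℕ) [NeZero r] (k c : ℝ) :
    ∃ C : ℝ, ∀ z : State r m, (∀ i < r, ‖auxError k (i + 1) z‖ ≤ c) → ‖z‖ ≤ C := by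
  let Ξ : State r m →ₗ[ℝ] (Fin r → Vec m) :=
    LinearMap.pi fun i => (auxErrorCLM r m k (i + 1)).toLinearMap
  obtain ⟨K, -, hK⟩ := Ξ.exists_antilipschitzWith (by
    rw [LinearMap.ker_eq_bot']
    intro z hz
    exact eq_zero_of_auxError_eq_zero k z fun i hi => congrFun hz ⟨i, hi⟩)
  refine ⟨K * c, fun z hz => ?_⟩
  have h1 := hK.le_mul_dist z 0
  rw [map_zero, dist_zero_right, dist_zero_right] at h1
  have h2 : ‖Ξ z‖ ≤ c := by
    rw [pi_norm_le_iff_of_nonempty]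
    exact fun i => hz i i.2
  exact h1.trans (by gcongr)

end AuxError

/-! ### Inward-pointing shells from the high-gain property. -/

section Gain

/-- `N` is bounded on each compact `[0, c]` but takes all real values, so it is unbounded in both
directions on `[c, ∞)` and takes every value there. Choosing `c` above all values of `γ` on `[0, η]`
forces the preimage under `γ` past `η`. -/
theorem IsGainPair.exists_mem_Ioo {N γ : ℝ → ℝ} (h : IsGainPair N γ) {η : ℝ}
    (hη1 : η < 1) (s : ℝ) : ∃ x ∈ Ioo η 1, 0 ≤ x ∧ N (γ x) = s := by
  obtain ⟨M, hM⟩ := (isCompact_Icc (a := (0 : ℝ)) (b := η)).exists_bound_of_continuousOn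
    (h.continuousOn_γ.mono fun x hx => ⟨hx.1, hx.2.trans_lt hη1⟩)
  set c := max M 1 + 1 with hc
  have hc1 : 1 ≤ c := by have := le_max_right M 1; linarith
  have hcM : M < c := by have := le_max_left M 1; linarith
  obtain ⟨B, hB⟩ := (isCompact_Icc (a := (0 : ℝ)) (b := c)).exists_bound_of_continuousOn
    (h.continuousOn_N.mono Icc_subset_Ici_self)
  have hout : ∀ y, B < |y| → ∃ a, c ≤ a ∧ N a = y := by
    intro y hy
    obtain ⟨a, ha, hay⟩ := h.surjOn_N (mem_univ y)
    refine ⟨a, ?_, hay⟩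
    by_contra hlt
    have := hB a ⟨ha, (not_le.1 hlt).le⟩
    rw [hay, Real.norm_eq_abs] at this
    linarith
  set R := max |s| B + 1 with hR
  have hsR : |s| < R := by have := le_max_left |s| B; linarith
  have hBR : B < R := by have := le_max_right |s| B; linarith
  have hR0 : 0 ≤ R := (abs_nonneg s).trans hsR.le
  obtain ⟨a, hac, ha⟩ := hout (-R) (by rwa [abs_neg, abs_of_nonneg hR0])
  obtain ⟨b, hbc, hb⟩ := hout R (by rwa [abs_of_nonneg hR0])
  have hsab := abs_le.1 hsR.le
  obtain ⟨y, hy, hys⟩ := (isPreconnected_Ici (a := c)).intermediate_value hac hbc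
    (h.continuousOn_N.mono (Ici_subset_Ici.2 (by linarith)))
    (show s ∈ Icc (N a) (N b) by rw [ha, hb]; exact hsab)
  obtain ⟨x, hx, hxy⟩ := h.bijOn_γ.surjOn (show y ∈ Ici (1 : ℝ) from hc1.trans hy)
  refine ⟨x, ⟨?_, hx.2⟩, hx.1, by rw [hxy, hys]⟩
  by_contra hlt
  have h1 := hM x ⟨hx.1, not_lt.1 hlt⟩
  rw [hxy] at h1
  have : y ≤ M := (le_abs_self y).trans h1
  have : c ≤ y := hy
  linarith

theorem IsGainPair.continuousOn_comp {N γ : ℝ → ℝ} (h : IsGainPair N γ) :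
    ContinuousOn (fun x => N (γ x)) (Ico 0 1) :=
  h.continuousOn_N.comp h.continuousOn_γ fun _ hx =>
    zero_le_one.trans (mem_Ici.1 (h.bijOn_γ.mapsTo hx))

variable {p q m : ℕ}

theorem highGainFun_le {f : Vec p × Vec q × Vec m → Vec m} (hf : Continuous f) {ν : ℝ}
    {Kp : Set (Vec p)} {Kq : Set (Vec q)} (hKp : IsCompact Kp) (hKq : IsCompact Kq) (s : ℝ)
    {δ : Vec p} (hδ : δ ∈ Kp) {z : Vec q} (hz : z ∈ Kq) {v : Vec m} (h1 : ν ≤ ‖v‖) (h2 : ‖v‖ ≤ 1) :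
    highGainFun f ν Kp Kq s ≤ inner ℝ v (f (δ, z, -(s • v))) := by
  refine csInf_le ?_ ⟨δ, hδ, z, hz, v, h1, h2, rfl⟩
  have hcomp : IsCompact (Kp ×ˢ Kq ×ˢ Metric.closedBall (0 : Vec m) 1) :=
    hKp.prod (hKq.prod (isCompact_closedBall 0 1))
  have hcont : Continuous fun x : Vec p × Vec q × Vec m =>
      inner ℝ x.2.2 (f (x.1, x.2.1, -(s • x.2.2))) := by fun_prop
  refine (hcomp.image hcont).bddBelow.mono ?_
  rintro a ⟨δ, hδ, z, hz, v, -, hv, rfl⟩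
  exact ⟨(δ, z, v), ⟨hδ, hz, by simpa using hv⟩, rfl⟩

theorem feedback_eq_smul (N γ : ℝ → ℝ) {α β : ℝ} (hα : 0 < α) (hβ : 0 < β) (e : Vec m) :
    feedback N γ α β e = (N (γ (‖(α / β) • e‖ ^ 2)) * (β / α)) • ((α / β) • e) := by
  rw [feedback, smul_smul]
  congr 1
  field_simp

/-- Spheres of radius close to one on which the feedback points inward arbitrarily strongly. -/
theorem exists_gain_barrier {f : Vec p × Vec q × Vec m → Vec m} (hf : Continuous f)
    (hg : HasHighGain f) {N γ : ℝ → ℝ} (hNγ : IsGainPair N γ) {α β : ℝ} (hα : 0 < α) (hβ : 0 < β)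
    {Kp : Set (Vec p)} {Kq : Set (Vec q)} (hKp : IsCompact Kp) (hKq : IsCompact Kq)
    (hKp' : Kp.Nonempty) (hKq' : Kq.Nonempty) {η : ℝ} (hη : η < 1) (L : ℝ) :
    ∃ κ ρ : ℝ, η < κ ∧ 0 < κ ∧ κ < 1 ∧ ρ < κ ∧ ∀ e : Vec m, ρ < ‖(α / β) • e‖ →
      ‖(α / β) • e‖ ≤ κ → ∀ δ ∈ Kp, ∀ z ∈ Kq,
        inner ℝ ((α / β) • e) (f (δ, z, feedback N γ α β e)) ≤ -L := by
  obtain ⟨ν, hν0, hν1, hν⟩ := hg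
  have hunb := hν Kp Kq hKp hKq hKp' hKq'
  obtain ⟨_, ⟨s, rfl⟩, hs⟩ := not_bddAbove_iff.1 hunb L
  set η' := max η ν with hη'
  have hη'1 : η' < 1 := max_lt hη hν1
  have hη'0 : 0 < η' := lt_max_of_lt_right hν0
  -- In terms of `w = (α/β) e` the feedback is `N(γ(‖w‖²)) (β/α) w`; the target `s (α/β)` makes it
  -- equal to `s w` when `‖w‖² = x`. The radius must also exceed `ν`, so that `-w` is admissible in
  -- `𝔥`.
  obtain ⟨x, hx, hx0, hNx⟩ := hNγ.exists_mem_Ioo (η := η' ^ 2) (by nlinarith) (s * (α / β))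
  set κ := Real.sqrt x with hκ
  have hκ2 : κ ^ 2 = x := Real.sq_sqrt hx0
  have hηκ : η' < κ := Real.lt_sqrt_of_sq_lt hx.1
  have hκ0 : 0 < κ := hη'0.trans hηκ
  have hκ1 : κ < 1 := by
    rw [hκ, Real.sqrt_lt' one_pos]; simpa using hx.2
  have hsκ : N (γ (κ ^ 2)) * (β / α) = s := by
    rw [hκ2, hNx]; field_simp
  have hNcont : ContinuousAt (fun ρ : ℝ => N (γ (ρ ^ 2))) κ := by
    have h1 : ContinuousAt (fun x => N (γ x)) (κ ^ 2) :=
      (hNγ.continuousOn_comp.mono Ioo_subset_Ico_self).continuousAt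
        (Ioo_mem_nhds (by positivity) (by nlinarith))
    exact ContinuousAt.comp (f := fun ρ : ℝ => ρ ^ 2) h1 (by fun_prop)
  have hK : IsCompact (Kp ×ˢ Kq ×ˢ Metric.sphere (0 : Vec m) 1) :=
    hKp.prod (hKq.prod (isCompact_sphere 0 1))
  -- At radius exactly `κ` the inequality is strict for all disturbances, operator values and
  -- directions; compactness extends it uniformly to nearby radii.
  have hev := hK.eventually_forall_of_forall_eventually (x₀ := κ)
    (P := fun ρ y => inner ℝ (ρ • y.2.2)
      (f (y.1, y.2.1, (N (γ (ρ ^ 2)) * (β / α)) • (ρ • y.2.2))) < -L) (by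
      rintro ⟨δ, z, n⟩ ⟨hδ, hz, hn⟩
      have hn1 : ‖n‖ = 1 := by simpa using hn
      have hnorm : ‖-(κ • n)‖ = κ := by
        rw [norm_neg, norm_smul, hn1, mul_one, Real.norm_eq_abs, abs_of_pos hκ0]
      have h1 := highGainFun_le hf (ν := ν) hKp hKq s hδ hz (v := -(κ • n))
        (by rw [hnorm]; exact (le_max_right _ _).trans hηκ.le) (by rw [hnorm]; exact hκ1.le)
      rw [smul_neg, neg_neg, inner_neg_left] at h1
      have hc : ContinuousAt (fun w : ℝ × (Vec p × Vec q × Vec m) => inner ℝ (w.1 • w.2.2.2)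
          (f (w.2.1, w.2.2.1, (N (γ (w.1 ^ 2)) * (β / α)) • (w.1 • w.2.2.2)))) (κ, (δ, z, n)) := by
        have h2 : ContinuousAt (fun w : ℝ × (Vec p × Vec q × Vec m) => N (γ (w.1 ^ 2)))
            (κ, (δ, z, n)) :=
          ContinuousAt.comp (f := fun w : ℝ × (Vec p × Vec q × Vec m) => w.1)
            (g := fun ρ : ℝ => N (γ (ρ ^ 2))) hNcont continuousAt_fst
        have h3 : ContinuousAt (fun w : ℝ × (Vec p × Vec q × Vec m) =>
            f (w.2.1, w.2.2.1, (N (γ (w.1 ^ 2)) * (β / α)) • (w.1 • w.2.2.2))) (κ, (δ, z, n)) := by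
          refine hf.continuousAt.comp (ContinuousAt.prodMk (by fun_prop)
            (ContinuousAt.prodMk (by fun_prop) ?_))
          exact (h2.mul continuousAt_const).smul (by fun_prop)
        have h4 : ContinuousAt (fun w : ℝ × (Vec p × Vec q × Vec m) => w.1 • w.2.2.2)
            (κ, (δ, z, n)) := by fun_prop
        exact h4.inner h3
      refine hc.eventually (gt_mem_nhds ?_)
      simp only [hsκ]
      linarith)
  obtain ⟨ε, hε, hball⟩ := Metric.eventually_nhds_iff.1 hev
  refine ⟨κ, max (κ - ε) 0, (le_max_left _ _).trans_lt hηκ, hκ0, hκ1, max_lt (by linarith) hκ0, ?_⟩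
  intro e he1 he2 δ hδ z hz
  rw [feedback_eq_smul N γ hα hβ]
  set w := (α / β) • e with hw
  have hw0 : 0 < ‖w‖ := (le_max_right _ _).trans_lt he1
  have hw1 : κ - ε < ‖w‖ := (le_max_left _ _).trans_lt he1
  have hdist : dist ‖w‖ κ < ε := by
    rw [Real.dist_eq, abs_of_nonpos (by linarith)]; linarith
  have := hball hdist (δ, z, ‖w‖⁻¹ • w) ⟨hδ, hz, by
    simp [norm_smul, hw0.ne']⟩
  simp only [smul_smul ‖w‖, mul_inv_cancel₀ hw0.ne', one_smul] at this
  exact this.le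

end Gain

/-! ### Local existence for causal functional differential equations. -/

section Peano

theorem intervalIntegrable_of_norm_le {E : Type*} [NormedAddCommGroup E] {F : ℝ → E} {M a u v : ℝ}
    (hM : ∀ s, ‖F s‖ ≤ M) (hF : ∀ τ, AEStronglyMeasurable F (volume.restrict (Icc a τ))) (hu : a ≤ u) (hv : a ≤ v) :
    IntervalIntegrable F volume u v := by
  have h1 : ∀ w, a ≤ w → IntervalIntegrable F volume a w := by
    intro w hw
    rw [intervalIntegrable_iff_integrableOn_Ioc_of_le hw]
    exact Integrable.of_bound
      ((hF w).mono_measure (Measure.restrict_mono Ioc_subset_Icc_self le_rfl)) M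
      (Eventually.of_forall hM)
  exact (h1 u hu).symm.trans (h1 v hv)

variable {E : Type*} [NormedAddCommGroup E] [NormedSpace ℝ E]

theorem lipschitzWith_primitive {F : ℝ → E} {M : ℝ≥0} {a : ℝ} (hM : ∀ s, ‖F s‖ ≤ M)
    (hF : ∀ τ, AEStronglyMeasurable F (volume.restrict (Icc a τ))) :
    LipschitzWith M (fun u => ∫ s in a..(max a u), F s) := by
  refine LipschitzWith.of_dist_le_mul fun u v => ?_
  rw [dist_eq_norm, intervalIntegral.integral_interval_sub_left
    (intervalIntegrable_of_norm_le hM hF le_rfl (le_max_left _ _))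
    (intervalIntegrable_of_norm_le hM hF le_rfl (le_max_left _ _))]
  refine (intervalIntegral.norm_integral_le_of_norm_le_const fun x _ => hM x).trans ?_
  gcongr
  rw [Real.dist_eq, max_comm a u, max_comm a v]
  exact abs_max_sub_max_le_abs u v a

/-- One step of the Tonelli iteration with delay `h`, for the functional right-hand side `𝓕`. -/
def delayStep (𝓕 : C(ℝ≥0, E) → ℝ → E) (M : ℝ≥0) (t₁ ε : ℝ≥0) (X₀ : C(ℝ≥0, E))
    (hM : ∀ Y s, ‖𝓕 Y s‖ ≤ M)
    (hmeas : ∀ Y τ, AEStronglyMeasurable (𝓕 Y) (volume.restrict (Icc (t₁ : ℝ) τ)))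
    (h : ℝ) (Y : C(ℝ≥0, E)) : C(ℝ≥0, E) where
  toFun t := X₀ (min t t₁) +
    ∫ s in (t₁ : ℝ)..(max (t₁ : ℝ) (max (t₁ : ℝ) (min (t₁ + ε) t) - h)), 𝓕 Y s
  continuous_toFun := by
    have h1 := (lipschitzWith_primitive (hM Y) (hmeas Y)).continuous
    have h2 : Continuous fun t : ℝ≥0 => max (t₁ : ℝ) (min (t₁ + ε) t) - h := by fun_prop
    exact (X₀.continuous.comp (by fun_prop)).add (h1.comp h2)

/-- Because of the delay and causality, the new function up to `t₁ + (j+1)h` depends on the old one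
only up to `t₁ + jh`. The iterates therefore stabilise on growing intervals, and finitely many reach
`t₁ + ε`. -/
theorem exists_delay_solution (𝓕 : C(ℝ≥0, E) → ℝ → E) (M : ℝ≥0) (t₁ ε : ℝ≥0) (X₀ : C(ℝ≥0, E))
    (hM : ∀ Y s, ‖𝓕 Y s‖ ≤ M)
    (hmeas : ∀ Y τ, AEStronglyMeasurable (𝓕 Y) (volume.restrict (Icc (t₁ : ℝ) τ)))
    (hcausal : ∀ (Y₁ Y₂ : C(ℝ≥0, E)) (t : ℝ≥0), t₁ ≤ t → (∀ s ≤ t, Y₁ s = Y₂ s) →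
      ∀ᵐ s ∂(volume.restrict (Icc (t₁ : ℝ) t)), 𝓕 Y₁ s = 𝓕 Y₂ s) {h : ℝ} (hh : 0 < h) :
    ∃ Y : C(ℝ≥0, E), ∀ t : ℝ≥0, Y t = X₀ (min t t₁) +
      ∫ s in (t₁ : ℝ)..(max (t₁ : ℝ) (max (t₁ : ℝ) (min (t₁ + ε) t) - h)), 𝓕 Y s := by
  set Ψ := delayStep 𝓕 M t₁ ε X₀ hM hmeas h with hΨ
  have hΨapply : ∀ Y t, Ψ Y t = X₀ (min t t₁) +
    ∫ s in (t₁ : ℝ)..(max (t₁ : ℝ) (max (t₁ : ℝ) (min (t₁ + ε) t) - h)), 𝓕 Y s := fun _ _ => rfl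
  have hagree : ∀ j : ℕ, ∀ t : ℝ≥0, (t : ℝ) ≤ t₁ + j * h → Ψ^[j + 1] X₀ t = Ψ^[j] X₀ t := by
    intro j
    induction j with
    | zero =>
      intro t ht
      have ht' : (t : ℝ) ≤ t₁ := by simpa using ht
      have ht'' : t ≤ t₁ := ht'
      simp only [zero_add, Function.iterate_one, Function.iterate_zero, id]
      rw [hΨapply, min_eq_left ht'', max_eq_left (a := (t₁ : ℝ)) (b := min _ _)
        ((min_le_right _ _).trans ht'), max_eq_left (by linarith), intervalIntegral.integral_same,
        add_zero]
    | succ j ih =>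
      intro t ht
      rw [Function.iterate_succ_apply', Function.iterate_succ_apply' Ψ j, hΨapply, hΨapply]
      congr 1
      set U := max (t₁ : ℝ) (max (t₁ : ℝ) (min (t₁ + ε) t) - h) with hU
      have hU1 : (t₁ : ℝ) ≤ U := le_max_left _ _
      have hU0 : 0 ≤ U := t₁.2.trans hU1
      have hjh : 0 ≤ j * h := by positivity
      have hU2 : U ≤ t₁ + j * h := by
        refine max_le (by linarith) ?_
        have : max (t₁ : ℝ) (min (t₁ + ε) t) ≤ t₁ + j * h + h := by
          refine max_le (by linarith) ((min_le_right _ _).trans ?_)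
          push_cast at ht
          linarith
        linarith
      have hae := hcausal (Ψ^[j + 1] X₀) (Ψ^[j] X₀) ⟨U, hU0⟩ hU1
        (fun s hs => ih s (le_trans (show (s : ℝ) ≤ U from hs) hU2))
      rw [ae_restrict_iff' measurableSet_Icc] at hae
      rw [Function.iterate_succ_apply'] at hae
      refine intervalIntegral.integral_congr_ae ?_
      filter_upwards [hae] with s hs hmem
      rw [uIoc_of_le hU1] at hmem
      exact hs ⟨hmem.1.le, hmem.2⟩
  obtain ⟨J, hJ⟩ := exists_nat_ge ((ε : ℝ) / h)
  have hJ' : (ε : ℝ) ≤ ((J + 1 : ℕ) : ℝ) * h := by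
    rw [div_le_iff₀ hh] at hJ
    push_cast
    linarith
  -- Past `t₁ + ε` the step is frozen, so agreement up to that time gives agreement everywhere.
  have hconst : ∀ Y t, Ψ Y t = Ψ Y (min t (t₁ + ε)) := by
    intro Y t
    rw [hΨapply, hΨapply]
    congr 2
    · rw [min_assoc, min_eq_right (a := t₁ + ε) le_self_add]
    · push_cast
      rw [min_comm (t : ℝ), ← min_assoc, min_self]
  refine ⟨Ψ^[J + 1] X₀, fun t => ?_⟩
  rw [← hΨapply, hconst, ← Function.iterate_succ_apply' Ψ (J + 1), hagree (J + 1)]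
  · rw [Function.iterate_succ_apply', ← hconst]
  · have : ((min t (t₁ + ε) : ℝ≥0) : ℝ) ≤ t₁ + ε := by
      push_cast
      exact min_le_right _ _
    linarith

/-- A Peano existence theorem for causal functional differential equations with bounded right-hand
side. -/
theorem exists_solution_of_causal [FiniteDimensional ℝ E] (𝓕 : C(ℝ≥0, E) → ℝ → E) (M : ℝ≥0)
    (t₁ ε : ℝ≥0) (X₀ : C(ℝ≥0, E)) (hM : ∀ Y s, ‖𝓕 Y s‖ ≤ M)
    (hmeas : ∀ Y τ, AEStronglyMeasurable (𝓕 Y) (volume.restrict (Icc (t₁ : ℝ) τ)))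
    (hcausal : ∀ (Y₁ Y₂ : C(ℝ≥0, E)) (t : ℝ≥0), t₁ ≤ t → (∀ s ≤ t, Y₁ s = Y₂ s) →
      ∀ᵐ s ∂(volume.restrict (Icc (t₁ : ℝ) t)), 𝓕 Y₁ s = 𝓕 Y₂ s)
    (hcont : ∀ (Y : ℕ → C(ℝ≥0, E)) (Z : C(ℝ≥0, E)), (∀ n, ∀ s ≤ t₁, Y n s = X₀ s) →
      (∀ s ≤ t₁, Z s = X₀ s) → (∀ n, ∀ s, t₁ ≤ s → ‖Y n s - X₀ t₁‖ ≤ M * ε) →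
      (∀ s, t₁ ≤ s → ‖Z s - X₀ t₁‖ ≤ M * ε) →
      TendstoUniformly (fun n s => Y n s) Z atTop →
      ∀ᵐ s ∂(volume.restrict (Icc (t₁ : ℝ) (t₁ + ε))),
        Tendsto (fun n => 𝓕 (Y n) s) atTop (𝓝 (𝓕 Z s))) :
    ∃ X : C(ℝ≥0, E), (∀ s ≤ t₁, X s = X₀ s) ∧ (∀ s, t₁ ≤ s → ‖X s - X₀ t₁‖ ≤ M * ε) ∧
      ∀ t : ℝ≥0, t₁ ≤ t → t ≤ t₁ + ε → X t = X₀ t₁ + ∫ s in (t₁ : ℝ)..t, 𝓕 X s := by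
  have hprop : ProperSpace E := FiniteDimensional.proper_real E
  set δ : ℕ → ℝ := fun n => 1 / ((n : ℝ) + 1) with hδ
  have hδ0 : ∀ n, 0 < δ n := fun n => by positivity
  choose Y hY using fun n => exists_delay_solution 𝓕 M t₁ ε X₀ hM hmeas hcausal (hδ0 n)
  have hle : (t₁ : ℝ) ≤ t₁ + ε := by linarith [ε.2]
  let α := Icc (t₁ : ℝ) (t₁ + ε)
  set g : ℕ → α → E := fun n u => ∫ s in (t₁ : ℝ)..(max (t₁ : ℝ) (u - δ n)), 𝓕 (Y n) s with hg
  have hglip : ∀ n, LipschitzWith M (g n) := by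
    intro n
    refine LipschitzWith.of_dist_le_mul fun u v => ?_
    have := (lipschitzWith_primitive (hM (Y n)) (hmeas (Y n))).dist_le_mul (u - δ n) (v - δ n)
    rwa [dist_sub_right] at this
  have hgbound : ∀ n u, ‖g n u‖ ≤ M * ε := by
    intro n u
    refine (intervalIntegral.norm_integral_le_of_norm_le_const fun x _ => hM (Y n) x).trans ?_
    gcongr
    rw [abs_of_nonneg (by linarith [le_max_left (t₁ : ℝ) (u - δ n)])]
    have : max (t₁ : ℝ) (u - δ n) ≤ t₁ + ε := max_le hle (by linarith [u.2.2, hδ0 n])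
    linarith
  -- The integral parts are equi-Lipschitz and uniformly bounded on a compact interval, as
  -- Arzelà–Ascoli requires.
  let G : ℕ → BoundedContinuousFunction α E := fun n =>
    BoundedContinuousFunction.mkOfCompact ⟨g n, (hglip n).continuous⟩
  have hcomp : IsCompact (closure (range G)) := by
    refine BoundedContinuousFunction.arzela_ascoli (Metric.closedBall 0 (M * ε))
      (isCompact_closedBall _ _) _ ?_ ?_
    · rintro f x ⟨n, rfl⟩
      rw [mem_closedBall_zero_iff]
      exact hgbound n x
    · refine (LipschitzWith.uniformEquicontinuous _ M ?_).equicontinuous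
      rintro ⟨_, n, rfl⟩
      exact hglip n
  obtain ⟨g', -, φ, hφ, hlim⟩ := hcomp.tendsto_subseq (x := G)
    (fun n => subset_closure (mem_range_self n))
  have hunif : TendstoUniformly (fun n => g (φ n)) g' atTop :=
    BoundedContinuousFunction.tendsto_iff_tendstoUniformly.1 hlim
  have hpt : ∀ u, Tendsto (fun n => g (φ n) u) atTop (𝓝 (g' u)) := fun u =>
    hunif.tendsto_at u
  let π : ℝ≥0 → α := fun t => projIcc (t₁ : ℝ) (t₁ + ε) hle t
  let X : C(ℝ≥0, E) := ⟨fun t => X₀ (min t t₁) + g' (π t), by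
    have : Continuous π := continuous_projIcc.comp continuous_subtype_val
    exact (X₀.continuous.comp (by fun_prop)).add (g'.continuous.comp this)⟩
  have hXapply : ∀ t, X t = X₀ (min t t₁) + g' (π t) := fun _ => rfl
  have hYapply : ∀ n t, Y n t = X₀ (min t t₁) + g n (π t) := fun n t => hY n t
  have hπ : ∀ t ≤ t₁, π t = ⟨t₁, le_rfl, hle⟩ := fun t ht => projIcc_of_le_left hle ht
  have hg0 : ∀ n, g n ⟨t₁, le_rfl, hle⟩ = 0 := by
    intro n
    simp only [hg]
    rw [max_eq_left (by linarith [hδ0 n]), intervalIntegral.integral_same]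
  have hg'0 : g' ⟨t₁, le_rfl, hle⟩ = 0 := by
    refine tendsto_nhds_unique (hpt _) ?_
    simp only [hg0]
    exact tendsto_const_nhds
  have hg'bound : ∀ u, ‖g' u‖ ≤ M * ε := fun u =>
    le_of_tendsto (hpt u).norm (Eventually.of_forall fun n => hgbound (φ n) u)
  have hX1 : ∀ s ≤ t₁, X s = X₀ s := by
    intro s hs
    rw [hXapply, hπ s hs, hg'0, min_eq_left hs, add_zero]
  have hY1 : ∀ n, ∀ s ≤ t₁, Y n s = X₀ s := by
    intro n s hs
    rw [hYapply, hπ s hs, hg0, min_eq_left hs, add_zero]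
  have hX2 : ∀ s, t₁ ≤ s → ‖X s - X₀ t₁‖ ≤ M * ε := by
    intro s hs
    rw [hXapply, min_eq_right hs, add_sub_cancel_left]
    exact hg'bound _
  have hY2 : ∀ n s, t₁ ≤ s → ‖Y n s - X₀ t₁‖ ≤ M * ε := by
    intro n s hs
    rw [hYapply, min_eq_right hs, add_sub_cancel_left]
    exact hgbound _ _
  have hYX : TendstoUniformly (fun n s => Y (φ n) s) X atTop := by
    rw [Metric.tendstoUniformly_iff] at hunif ⊢
    intro η hη
    filter_upwards [hunif η hη] with n hn s
    rw [hXapply, hYapply, dist_add_left]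
    exact hn _
  have hae := hcont (fun n => Y (φ n)) X (fun n => hY1 _) hX1 (fun n => hY2 _) hX2 hYX
  refine ⟨X, hX1, hX2, fun t ht1 ht2 => ?_⟩
  have ht1' : (t₁ : ℝ) ≤ t := ht1
  have ht2' : (t : ℝ) ≤ t₁ + ε := by exact_mod_cast ht2
  have hπt : π t = ⟨t, ht1', ht2'⟩ := projIcc_of_mem hle ⟨ht1', ht2'⟩
  rw [hXapply, min_eq_right ht1, hπt]
  congr 1
  have hdct : Tendsto (fun n => ∫ s in (t₁ : ℝ)..t, 𝓕 (Y (φ n)) s) atTop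
      (𝓝 (∫ s in (t₁ : ℝ)..t, 𝓕 X s)) := by
    refine intervalIntegral.tendsto_integral_filter_of_dominated_convergence (fun _ => (M : ℝ))
      ?_ ?_ (by simp) ?_
    · refine Eventually.of_forall fun n => ?_
      rw [uIoc_of_le ht1']
      exact (hmeas _ t).mono_measure (Measure.restrict_mono Ioc_subset_Icc_self le_rfl)
    · exact Eventually.of_forall fun n => Eventually.of_forall fun s _ => hM _ s
    · rw [ae_restrict_iff' measurableSet_Icc] at hae
      filter_upwards [hae] with s hs hmem
      rw [uIoc_of_le ht1'] at hmem
      exact hs ⟨hmem.1.le, hmem.2.trans ht2'⟩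
  -- Removing the delay costs at most `M` times its length, which tends to zero.
  have hdiff : Tendsto (fun n => g (φ n) ⟨t, ht1', ht2'⟩ - ∫ s in (t₁ : ℝ)..t, 𝓕 (Y (φ n)) s) atTop
      (𝓝 0) := by
    have hz : Tendsto (fun n => (M : ℝ) * δ (φ n)) atTop (𝓝 0) := by
      simpa [hδ] using ((tendsto_one_div_add_atTop_nhds_zero_nat (𝕜 := ℝ)).comp
        hφ.tendsto_atTop).const_mul (M : ℝ)
    refine squeeze_zero_norm (fun n => ?_) hz
    have h1 := (lipschitzWith_primitive (hM (Y (φ n))) (hmeas (Y (φ n)))).dist_le_mul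
      (t - δ (φ n)) t
    rw [max_eq_right ht1', dist_eq_norm, Real.dist_eq, sub_sub_cancel_left, abs_neg,
      abs_of_pos (hδ0 _)] at h1
    exact h1
  have := hdiff.add hdct
  simp only [sub_add_cancel, zero_add] at this
  exact tendsto_nhds_unique (hpt _) this

/-- Radial retraction onto the ball of radius `M`. -/
def radialClamp (M : ℝ) (v : E) : E := (M / max M ‖v‖) • v

theorem continuous_radialClamp {M : ℝ} (hM : 0 < M) : Continuous (radialClamp M : E → E) := by
  unfold radialClamp
  refine Continuous.smul (Continuous.div continuous_const (by fun_prop) fun v => ?_) continuous_id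
  exact (lt_max_of_lt_left hM).ne'

theorem norm_radialClamp_le {M : ℝ} (hM : 0 < M) (v : E) : ‖radialClamp M v‖ ≤ M := by
  have h1 : 0 < max M ‖v‖ := lt_max_of_lt_left hM
  rw [radialClamp, norm_smul, Real.norm_eq_abs, abs_of_pos (div_pos hM h1), div_mul_eq_mul_div,
    div_le_iff₀ h1]
  gcongr
  exact le_max_right _ _

theorem radialClamp_of_le {M : ℝ} (hM : 0 < M) {v : E} (h : ‖v‖ ≤ M) : radialClamp M v = v := by
  rw [radialClamp, max_eq_left h, div_self hM.ne', one_smul]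

/-- Local existence for `x' = G(D, x, T x)` with an admissible operator `T`, continuous `G` and
bounded measurable `D`, starting at time `t₁` from the history `X₀`. -/
theorem exists_local_solution {E W : Type*} [NormedAddCommGroup E] [NormedSpace ℝ E]
    [FiniteDimensional ℝ E] [NormedAddCommGroup W] [ProperSpace W] {q : ℕ} {t₀ t₁ : ℝ≥0}
    {T : C(ℝ≥0, E) → ℝ → Vec q} (hT : IsAdmissibleOperator t₀ T) {G : W × E × Vec q → E}
    (hG : Continuous G) {D : ℝ → W} (hD : MemLp D ∞ (volume.restrict (Ici (t₀ : ℝ))))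
    (h01 : t₀ ≤ t₁) (X₀ : C(ℝ≥0, E)) :
    ∃ ε : ℝ≥0, 0 < ε ∧ ∃ X : C(ℝ≥0, E), ∃ F : ℝ → E, ∃ M : ℝ≥0, (∀ s ≤ t₁, X s = X₀ s) ∧
      (∀ s, ‖F s‖ ≤ M) ∧
      (∀ τ, AEStronglyMeasurable F (volume.restrict (Icc (t₁ : ℝ) τ))) ∧
      (∀ᵐ s ∂(volume.restrict (Icc (t₁ : ℝ) (t₁ + ε))), F s = G (D s, X s.toNNReal, T X s)) ∧
      ∀ t : ℝ≥0, t₁ ≤ t → t ≤ t₁ + ε → X t = X₀ t₁ + ∫ s in (t₁ : ℝ)..t, F s := by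
  have hprop : ProperSpace E := FiniteDimensional.proper_real E
  -- The history frozen at `t₁`: a reference function for bounding `T` along candidates via the
  -- Lipschitz estimate.
  let S : C(ℝ≥0, E) := X₀.comp ⟨fun t => min t t₁, by fun_prop⟩
  have hS1 : ∀ s ≤ t₁, S s = X₀ s := fun s hs => by
    change X₀ (min s t₁) = _
    rw [min_eq_left hs]
  have hS2 : ∀ s, t₁ ≤ s → S s = X₀ t₁ := fun s hs => by
    change X₀ (min s t₁) = _
    rw [min_eq_right hs]
  obtain ⟨Δ, δ, c, hΔ, hδ, hc, hlip⟩ := hT.locallyLipschitz t₁ h01 X₀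
  obtain ⟨B₀, hB₀, hTS⟩ := ae_norm_le_of_memLp_top (hT.locallyBounded S (t₁ + Δ))
  obtain ⟨C, hC, hDC⟩ := ae_norm_le_of_memLp_top hD
  have hK : IsCompact (Metric.closedBall (0 : W) C ×ˢ Metric.closedBall (X₀ t₁) δ ×ˢ
      Metric.closedBall (0 : Vec q) (B₀ + c * δ)) :=
    (isCompact_closedBall _ _).prod ((isCompact_closedBall _ _).prod (isCompact_closedBall _ _))
  obtain ⟨M₀, hM₀⟩ := hK.exists_bound_of_continuousOn hG.continuousOn
  set M : ℝ≥0 := M₀.toNNReal + 1 with hMdef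
  have hM0 : (0 : ℝ) < M := by
    have : (0 : ℝ≥0) < M := by positivity
    exact_mod_cast this
  have hM₀M : M₀ ≤ M := by
    have h1 := Real.le_coe_toNNReal M₀
    rw [hMdef]; push_cast; linarith
  -- With speed at most `M`, candidates stay in the `δ`-ball for time `ε`. There the Lipschitz
  -- estimate applies, and the bound `M₀` will show that the solution never activates the clamp.
  obtain ⟨ε, hε, hεΔ, hεδ⟩ : ∃ ε : ℝ≥0, 0 < ε ∧ ε ≤ Δ ∧ (M : ℝ) * ε < δ := by
    refine ⟨min Δ (δ / (2 * M)).toNNReal, ?_, min_le_left _ _, ?_⟩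
    · exact lt_min hΔ (Real.toNNReal_pos.2 (by positivity))
    · have : ((min Δ (δ / (2 * M)).toNNReal : ℝ≥0) : ℝ) ≤ δ / (2 * M) := by
        rw [NNReal.coe_min, Real.coe_toNNReal _ (by positivity)]; exact min_le_right _ _
      calc _ ≤ (M : ℝ) * (δ / (2 * M)) := by gcongr
        _ = δ / 2 := by field_simp
        _ < δ := by linarith
  set 𝓕 : C(ℝ≥0, E) → ℝ → E := fun Y s => radialClamp M (G (D s, Y s.toNNReal, T Y s)) with h𝓕
  have hsub : ∀ τ, Icc (t₁ : ℝ) τ ⊆ Icc (t₀ : ℝ) τ := fun τ =>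
    Icc_subset_Icc_left (by exact_mod_cast h01)
  have hmeas : ∀ Y τ, AEStronglyMeasurable (𝓕 Y) (volume.restrict (Icc (t₁ : ℝ) τ)) := by
    intro Y τ
    refine (continuous_radialClamp hM0).comp_aestronglyMeasurable
      (hG.comp_aestronglyMeasurable (AEStronglyMeasurable.prodMk ?_
        (AEStronglyMeasurable.prodMk ?_ ?_)))
    · refine hD.1.mono_measure (Measure.restrict_mono ?_ le_rfl)
      exact (hsub τ).trans Icc_subset_Ici_self
    · exact (Y.continuous.comp continuous_real_toNNReal).aestronglyMeasurable
    · exact (hT.locallyBounded Y τ).1.mono_measure (Measure.restrict_mono (hsub τ) le_rfl)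
  have hcausal : ∀ (Y₁ Y₂ : C(ℝ≥0, E)) (t : ℝ≥0), t₁ ≤ t → (∀ s ≤ t, Y₁ s = Y₂ s) →
      ∀ᵐ s ∂(volume.restrict (Icc (t₁ : ℝ) t)), 𝓕 Y₁ s = 𝓕 Y₂ s := by
    intro Y₁ Y₂ t ht hY
    filter_upwards [ae_restrict_of_ae_restrict_of_subset (hsub t)
      (hT.causal Y₁ Y₂ t (h01.trans ht) hY), ae_restrict_mem measurableSet_Icc] with s hs hmem
    simp only [h𝓕]
    rw [hs, hY s.toNNReal (Real.toNNReal_le_iff_le_coe.2 hmem.2)]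
  have hLip : ∀ (Y Z : C(ℝ≥0, E)) (η : ℝ), (∀ s ≤ t₁, Y s = X₀ s) → (∀ s ≤ t₁, Z s = X₀ s) →
      (∀ s, t₁ ≤ s → ‖Y s - X₀ t₁‖ ≤ M * ε) → (∀ s, t₁ ≤ s → ‖Z s - X₀ t₁‖ ≤ M * ε) →
      (∀ s, ‖Y s - Z s‖ ≤ η) →
      ∀ᵐ s ∂(volume.restrict (Icc (t₁ : ℝ) (t₁ + Δ))), ‖T Y s - T Z s‖ ≤ c * η := by
    intro Y Z η hY1 hZ1 hY2 hZ2 hη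
    filter_upwards [hlip Y Z hY1 hZ1 (fun s hs => (hY2 s hs.1).trans_lt hεδ)
      (fun s hs => (hZ2 s hs.1).trans_lt hεδ)] with s hs
    refine hs.trans (mul_le_mul_of_nonneg_left ?_ hc.le)
    refine csSup_le ((nonempty_Icc.2 le_self_add).image _) ?_
    rintro _ ⟨u, -, rfl⟩
    exact hη u
  obtain ⟨X, hX1, hX2, hX3⟩ := exists_solution_of_causal 𝓕 M t₁ ε X₀
    (fun Y s => norm_radialClamp_le hM0 _) hmeas hcausal (by
      intro Y Z hY1 hZ1 hY2 hZ2 hYZ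
      have hsup : ∀ n, ∃ η : ℝ, 0 ≤ η ∧ ∀ s, ‖Y n s - Z s‖ ≤ η := by
        intro n
        refine ⟨2 * (M * ε), by positivity, fun s => ?_⟩
        rcases le_total s t₁ with hs | hs
        · rw [hY1 n s hs, hZ1 s hs, sub_self, norm_zero]; positivity
        · calc ‖Y n s - Z s‖ = ‖(Y n s - X₀ t₁) - (Z s - X₀ t₁)‖ := by rw [sub_sub_sub_cancel_right]
            _ ≤ _ := norm_sub_le _ _
            _ ≤ M * ε + M * ε := add_le_add (hY2 n s hs) (hZ2 s hs)
            _ = _ := by ring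
      have hbdd : ∀ n, BddAbove (range fun s => ‖Y n s - Z s‖) := fun n => by
        obtain ⟨η, -, h⟩ := hsup n
        exact ⟨η, by rintro _ ⟨s, rfl⟩; exact h s⟩
      have hη : Tendsto (fun n => ⨆ s, ‖Y n s - Z s‖) atTop (𝓝 0) := by
        rw [Metric.tendsto_atTop]
        intro η hη
        rw [Metric.tendstoUniformly_iff] at hYZ
        obtain ⟨N, hN⟩ := eventually_atTop.1 (hYZ (η / 2) (by positivity))
        refine ⟨N, fun n hn => ?_⟩
        rw [Real.dist_0_eq_abs, abs_of_nonneg (Real.iSup_nonneg fun s => norm_nonneg _)]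
        refine (ciSup_le fun s => ?_).trans_lt (half_lt_self hη)
        rw [← dist_eq_norm, dist_comm]
        exact (hN n hn s).le
      have hT' := ae_all_iff.2 fun n => hLip (Y n) Z _ (hY1 n) hZ1 (hY2 n) hZ2
        (fun s => le_ciSup (hbdd n) s)
      have hsubΔ : Icc (t₁ : ℝ) (t₁ + ε) ⊆ Icc (t₁ : ℝ) (t₁ + Δ) :=
        Icc_subset_Icc_right (by gcongr)
      filter_upwards [ae_restrict_of_ae_restrict_of_subset hsubΔ hT'] with s hs
      have hTs : Tendsto (fun n => T (Y n) s) atTop (𝓝 (T Z s)) := by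
        rw [tendsto_iff_norm_sub_tendsto_zero]
        refine squeeze_zero (fun n => norm_nonneg _) hs ?_
        simpa using hη.const_mul c
      exact ((continuous_radialClamp hM0).comp hG).continuousAt.tendsto.comp
        (tendsto_const_nhds.prodMk_nhds ((hYZ.tendsto_at _).prodMk_nhds hTs)))
  refine ⟨ε, hε, X, 𝓕 X, M, hX1, fun s => norm_radialClamp_le hM0 _, hmeas X, ?_, hX3⟩
  have hXS := hLip X S (M * ε) hX1 hS1 hX2 (fun s hs => by
    rw [hS2 s hs, sub_self, norm_zero]; positivity) (fun s => by
    rcases le_total s t₁ with hs | hs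
    · rw [hX1 s hs, hS1 s hs, sub_self, norm_zero]; positivity
    · rw [hS2 s hs]; exact hX2 s hs)
  have hsubΔ : Icc (t₁ : ℝ) (t₁ + ε) ⊆ Icc (t₁ : ℝ) (t₁ + Δ) :=
    Icc_subset_Icc_right (by gcongr)
  filter_upwards [ae_restrict_of_ae_restrict_of_subset hsubΔ hXS,
    ae_restrict_of_ae_restrict_of_subset (hsubΔ.trans (hsub _)) hTS,
    ae_restrict_of_ae_restrict_of_subset ((hsub _).trans Icc_subset_Ici_self) hDC,
    ae_restrict_mem measurableSet_Icc] with s h1 h2 h3 h4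
  refine radialClamp_of_le hM0 ((hM₀ _ ⟨?_, ?_, ?_⟩).trans hM₀M)
  · simpa using h3
  · rw [Metric.mem_closedBall, dist_eq_norm]
    exact (hX2 _ (NNReal.le_toNNReal_of_coe_le h4.1)).trans hεδ.le
  · rw [mem_closedBall_zero_iff]
    calc ‖T X s‖ = ‖T S s + (T X s - T S s)‖ := by rw [add_sub_cancel]
      _ ≤ ‖T S s‖ + ‖T X s - T S s‖ := norm_add_le _ _
      _ ≤ B₀ + c * δ := by
        refine add_le_add h2 (h1.trans ?_)
        gcongr

end Peano

/-! ### Regularity and bounds of the reference jet. -/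

section Jet

variable {r m : ℕ} {Y : ℕ → ℝ → Vec m}

theorem IsSobolevJet.ae_hasDerivAt_jet (h : IsSobolevJet r Y) {a b : ℝ} (ha : 0 ≤ a)
    (hab : a ≤ b) : ∀ᵐ t ∂(volume.restrict (Icc a b)),
      HasDerivAt (jet r Y) (shiftAppend (jet r Y t) (Y r t)) t := by
  have h1 : ∀ i : Fin r, ∀ᵐ t ∂(volume.restrict (Icc a b)), HasDerivAt (Y i) (Y (i + 1) t) t :=
    fun i => (h.hasWeakDeriv i i.2).ae_hasDerivAt (h.continuousOn i i.2) (h.memLp (i + 1) i.2) ha hab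
  filter_upwards [ae_all_iff.2 h1] with t ht
  rw [hasDerivAt_state_iff]
  intro i
  have h2 : shiftAppend (jet r Y t) (Y r t) i = Y (i + 1) t := by
    by_cases hi : (i : ℕ) + 1 < r
    · simp [shiftAppend, jet, hi]
    · have : (i : ℕ) + 1 = r := by omega
      simp [shiftAppend, this]
  rw [h2]
  exact ht i

theorem IsSobolevJet.exists_lipschitzOnWith_jet (h : IsSobolevJet r Y) :
    ∃ K : ℝ≥0, LipschitzOnWith K (jet r Y) (Ici 0) := by
  choose K hK using fun i : Fin r =>
    (h.hasWeakDeriv i i.2).exists_lipschitzOnWith (h.continuousOn i i.2) (h.memLp (i + 1) i.2)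
  have h1 : LipschitzOnWith (∑ i, K i) (fun t => (fun i : Fin r => Y i t)) (Ici 0) := by
    refine LipschitzOnWith.of_dist_le_mul fun s hs t ht => ?_
    rw [dist_pi_le_iff (by positivity)]
    intro i
    refine ((hK i).dist_le_mul s hs t ht).trans ?_
    gcongr
    exact Finset.single_le_sum (f := K) (fun _ _ => zero_le) (Finset.mem_univ i)
  exact ⟨_, (PiLp.lipschitzWith_toLp 2 (fun _ : Fin r => Vec m)).comp_lipschitzOnWith h1⟩

theorem IsSobolevJet.continuousOn_jet (h : IsSobolevJet r Y) : ContinuousOn (jet r Y) (Ici 0) :=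
  let ⟨_, hK⟩ := h.exists_lipschitzOnWith_jet
  hK.continuousOn

theorem IsSobolevJet.absolutelyContinuous_jet (h : IsSobolevJet r Y) {a b : ℝ} (ha : 0 ≤ a)
    (hab : a ≤ b) : AbsolutelyContinuousOnInterval (jet r Y) a b := by
  obtain ⟨K, hK⟩ := h.exists_lipschitzOnWith_jet
  refine (hK.mono ?_).absolutelyContinuousOnInterval
  rw [uIcc_of_le hab]
  exact fun x hx => ha.trans hx.1

theorem IsSobolevJet.exists_norm_jet_le (h : IsSobolevJet r Y) :
    ∃ C : ℝ, ∀ t, 0 ≤ t → ‖jet r Y t‖ ≤ C := by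
  choose C hC using fun i : Fin r =>
    exists_norm_le_of_continuousOn_memLp_top (h.continuousOn i i.2) (h.memLp i i.2.le)
  refine ⟨∑ i, C i, fun t ht => ?_⟩
  calc ‖jet r Y t‖ ≤ ∑ i, ‖jet r Y t i‖ := by
        rw [PiLp.norm_eq_of_L2]
        refine Real.sqrt_le_iff.2 ⟨by positivity, ?_⟩
        exact Finset.sum_sq_le_sq_sum_of_nonneg fun _ _ => norm_nonneg _
    _ ≤ ∑ i, C i := Finset.sum_le_sum fun i _ => hC i t ht

theorem IsSobolevJet.memLp_jet (h : IsSobolevJet r Y) (t₀ : ℝ≥0) :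
    MemLp (jet r Y) ∞ (volume.restrict (Ici (t₀ : ℝ))) := by
  obtain ⟨C, hC⟩ := h.exists_norm_jet_le
  refine memLp_top_of_bound ((h.continuousOn_jet.mono (Ici_subset_Ici.2 t₀.2)).aestronglyMeasurable
    measurableSet_Ici) C ?_
  filter_upwards [ae_restrict_mem measurableSet_Ici] with t ht using hC t (t₀.2.trans ht)

end Jet

/-! ### Propagation of bounds down the error chain. -/

section Chain

variable {r m : ℕ} [NeZero r]

/-- Bounds along the chain `ξ_i' = ξ_{i+1} - k ξ_i`. -/
theorem norm_auxError_le_of_chain {E : ℝ → State r m} {w : ℝ → Vec m} {k c a τ : ℝ} (hk : 1 ≤ k)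
    (hc : 0 ≤ c) (hAC : AbsolutelyContinuousOnInterval E a τ)
    (hd : ∀ᵐ t ∂(volume.restrict (Icc a τ)), HasDerivAt E (shiftAppend (E t) (w t)) t)
    (hr : ∀ t ∈ Icc a τ, ‖auxError k r (E t)‖ ≤ c)
    (h0 : ∀ i : ℕ, 2 ≤ i → i ≤ r → ‖auxError k i (E a)‖ ≤ c) :
    (∀ i : ℕ, 2 ≤ i → i ≤ r → ∀ t ∈ Icc a τ, ‖auxError k i (E t)‖ ≤ c) ∧
    (1 < r → ∀ t ∈ Icc a τ, ‖auxError k 1 (E t)‖ ≤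
      Real.exp (-(k * (t - a))) * ‖auxError k 1 (E a)‖ +
        c / k * (1 - Real.exp (-(k * (t - a))))) := by
  have hk0 : 0 < k := by linarith
  have step : ∀ i, i + 1 < r → (∀ t ∈ Icc a τ, ‖auxError k (i + 2) (E t)‖ ≤ c) →
      ∀ t ∈ Icc a τ, ‖auxError k (i + 1) (E t)‖ ≤
        Real.exp (-(k * (t - a))) * ‖auxError k (i + 1) (E a)‖ +
          c / k * (1 - Real.exp (-(k * (t - a)))) := by
    intro i hi hbound t ht
    refine norm_le_of_ae_hasDerivAt_decay (g := fun t => auxError k (i + 1) (E t))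
      (h := fun t => auxError k (i + 2) (E t)) hk0 ht.1 ?_ ?_
      (fun s hs => hbound s ⟨hs.1, hs.2.trans ht.2⟩)
    · refine absolutelyContinuous_clm_comp (auxErrorCLM r m k (i + 1)) (hAC.mono ?_)
      rw [uIcc_of_le ht.1, uIcc_of_le (ht.1.trans ht.2)]
      exact Icc_subset_Icc_right ht.2
    · filter_upwards [ae_restrict_of_ae_restrict_of_subset (Icc_subset_Icc_right ht.2) hd] with s hs
      have := (auxErrorCLM r m k (i + 1)).hasFDerivAt.comp_hasDerivAt s hs
      rw [auxErrorCLM_apply, auxError_shiftAppend_of_lt k hi] at this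
      exact this
  -- Downward induction from `i = r`: by variation of constants each `ξ_i` stays below a convex
  -- combination of its initial value and `c / k ≤ c`.
  have down : ∀ n i : ℕ, i + n = r → 2 ≤ i → ∀ t ∈ Icc a τ, ‖auxError k i (E t)‖ ≤ c := by
    intro n
    induction n with
    | zero =>
      intro i hi _ t ht
      obtain rfl : i = r := by omega
      exact hr t ht
    | succ n ih =>
      intro i hi h2 t ht
      obtain ⟨j, rfl⟩ : ∃ j, i = j + 1 := ⟨i - 1, by omega⟩
      have h1 := step j (by omega) (ih (j + 2) (by omega) (by omega)) t ht
      have h3 := h0 (j + 1) h2 (by omega)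
      set e := Real.exp (-(k * (t - a))) with he
      have he0 : 0 < e := Real.exp_pos _
      have he1 : e ≤ 1 := by
        rw [he, Real.exp_le_one_iff]
        have : 0 ≤ k * (t - a) := mul_nonneg hk0.le (by linarith [ht.1])
        linarith
      have hck : c / k ≤ c := div_le_self hc hk
      calc _ ≤ _ := h1
        _ ≤ e * c + c * (1 - e) := by
          gcongr
        _ = c := by ring
  refine ⟨fun i h2 hi => down (r - i) i (by omega) h2, fun h1r => ?_⟩
  exact step 0 h1r (down (r - 2) 2 (by omega) le_rfl)

end Chain

/-! ### Lower growth bound for the funnel function. -/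

section Funnel

theorem IsFunnel.exp_mul_le {α β : ℝ} {ψ : ℝ → ℝ} (h : IsFunnel α β ψ) {a t : ℝ} (ha : 0 ≤ a)
    (hat : a ≤ t) : Real.exp (-(α * (t - a))) * (ψ a - β / α) ≤ ψ t - β / α := by
  obtain ⟨hα, hβ, -, Y, hY, rfl, hae⟩ := h
  have hw := hY.hasWeakDeriv 0 one_pos
  have hcont := hY.continuousOn 0 one_pos
  have hmem := hY.memLp 1 le_rfl
  have hexp : ∀ t, HasDerivAt (fun t => Real.exp (α * (t - a))) (Real.exp (α * (t - a)) * α) t := by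
    intro t
    have := (((hasDerivAt_id t).sub_const a).const_mul α).exp
    simpa using this
  have hAC : AbsolutelyContinuousOnInterval (fun t => Real.exp (α * (t - a))) a t :=
    ContDiffOn.absolutelyContinuousOnInterval (by fun_prop)
  have hconst : AbsolutelyContinuousOnInterval (fun _ : ℝ => β / α) a t :=
    ContDiffOn.absolutelyContinuousOnInterval (by fun_prop)
  have hψ := hw.absolutelyContinuous hcont hmem ha hat
  -- Gronwall: the inequality `ψ' ≥ -α ψ + β` says exactly that this weighted gap is nonincreasing.
  have h1 := le_of_ae_deriv_nonpos (g := fun t => Real.exp (α * (t - a)) * (β / α - Y 0 t)) hat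
    (hAC.mul (hconst.sub hψ)) (by
      filter_upwards [hw.ae_hasDerivAt hcont hmem ha hat,
        ae_restrict_of_ae_restrict_of_subset (fun x hx => ha.trans hx.1) hae] with s h1 h2
      refine ⟨_, (hexp s).mul (h1.const_sub (β / α)), ?_⟩
      have : Real.exp (α * (s - a)) * α * (β / α - Y 0 s) + Real.exp (α * (s - a)) * -Y (0 + 1) s
        = Real.exp (α * (s - a)) * ((-α * Y 0 s + β) - Y 1 s) := by
        field_simp; ring
      rw [this]
      exact mul_nonpos_of_nonneg_of_nonpos (Real.exp_pos _).le (by linarith))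
  simp only [sub_self, mul_zero, Real.exp_zero, one_mul] at h1
  rw [Real.exp_neg, inv_mul_le_iff₀ (Real.exp_pos _)]
  linarith

end Funnel

/-! ### A barrier argument. -/

section Barrier

/-- A function that is nonincreasing wherever its values lie in `(ρ, κ]` does not reach `κ` from
below. -/
theorem lt_of_barrier {v : ℝ → ℝ} {a b ρ κ : ℝ} (hab : a ≤ b)
    (hv : AbsolutelyContinuousOnInterval v a b) (hρ : ρ < κ) (ha : v a < κ)
    (hd : ∀ᵐ t ∂(volume.restrict (Icc a b)), ρ < v t → v t ≤ κ → ∃ v', HasDerivAt v v' t ∧ v' ≤ 0) :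
    v b < κ := by
  by_contra hb
  rw [not_lt] at hb
  have hcont : ContinuousOn v (Icc a b) := by
    have := hv.continuousOn
    rwa [uIcc_of_le hab] at this
  set S := Icc a b ∩ v ⁻¹' Ici κ with hS
  have hSc : IsCompact S := isCompact_Icc.of_isClosed_subset
    (hcont.preimage_isClosed_of_isClosed isClosed_Icc isClosed_Ici) inter_subset_left
  -- The first time at level `κ`. Just before it the values lie in `(ρ, κ]`, where `v` cannot
  -- increase, so `v` could not have come from below `κ`.
  obtain ⟨t, ⟨htI, htκ⟩, htmin⟩ := hSc.exists_isLeast ⟨b, ⟨hab, le_rfl⟩, hb⟩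
  have hbefore : ∀ s ∈ Ico a t, v s < κ := by
    intro s hs
    by_contra h
    exact absurd (htmin ⟨⟨hs.1, hs.2.le.trans htI.2⟩, not_lt.1 h⟩) (not_le.2 hs.2)
  have hat : a < t := by
    refine lt_of_le_of_ne htI.1 ?_
    rintro rfl
    exact absurd htκ (not_le.2 ha)
  have hct : ContinuousWithinAt v (Icc a t) t :=
    (hcont t htI).mono (Icc_subset_Icc_right htI.2)
  have hle : v t ≤ κ := by
    have hne : (𝓝[Ico a t] t).NeBot := by
      rw [nhdsWithin_Ico_eq_nhdsLT hat]; infer_instance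
    refine le_of_tendsto (hct.mono Ico_subset_Icc_self) ?_
    filter_upwards [self_mem_nhdsWithin] with s hs using (hbefore s hs).le
  have hev : {s | ρ < v s} ∈ 𝓝[≤] t := by
    rw [← nhdsWithin_Icc_eq_nhdsLE hat]
    exact hct.eventually (lt_mem_nhds (hρ.trans_le htκ))
  obtain ⟨l, hl, hsub⟩ := (mem_nhdsLE_iff_exists_mem_Ico_Ioc_subset hat).1 hev
  obtain ⟨s, hls, hst⟩ := exists_between hl.2
  have has : a ≤ s := hl.1.trans hls.le
  have hsub' : Icc s t ⊆ Icc a b := Icc_subset_Icc has htI.2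
  have h1 := le_of_ae_deriv_nonpos hst.le (hv.mono (by
    rw [uIcc_of_le hst.le, uIcc_of_le hab]; exact hsub')) (by
      filter_upwards [ae_restrict_of_ae_restrict_of_subset hsub' hd,
        ae_restrict_mem measurableSet_Icc] with x hx hmem
      refine hx (hsub ⟨hls.trans_le hmem.1, hmem.2⟩) ?_
      rcases hmem.2.eq_or_lt with rfl | hlt
      · exact hle
      · exact (hbefore x ⟨has.trans hmem.1, hlt⟩).le)
  have h2 := hbefore s ⟨has, hst⟩
  have h3 : κ ≤ v t := htκ
  linarith

end Barrier

/-! ### Extending closed-loop solutions to the right. -/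

section Extension

variable {m r p q : ℕ} [NeZero r] {t₀ : ℝ≥0} {d : ℝ → Vec p}
  {f : Vec p × Vec q × Vec m → Vec m} {T : C(ℝ≥0, State r m) → ℝ → Vec q}
  {x₀ : ℝ → State r m} {N γ : ℝ → ℝ} {α β k : ℝ} {yref : ℕ → ℝ → Vec m}

theorem continuous_cutoff_feedback (hNγ : IsGainPair N γ) (α β : ℝ) {κ : ℝ} (hκ0 : 0 ≤ κ)
    (hκ1 : κ < 1) :
    Continuous fun e : Vec m => N (γ (min (‖(α / β) • e‖ ^ 2) (κ ^ 2))) • e := by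
  have hmin : Continuous fun e : Vec m => min (‖(α / β) • e‖ ^ 2) (κ ^ 2) := by fun_prop
  have h : Continuous fun e : Vec m => N (γ (min (‖(α / β) • e‖ ^ 2) (κ ^ 2))) :=
    hNγ.continuousOn_comp.comp_continuous hmin fun e =>
      ⟨by positivity, (min_le_right _ _).trans_lt (by nlinarith)⟩
  exact h.smul continuous_id

/-- A solution on `[t₀, t₁]` that keeps the control law defined extends beyond `t₁`. -/
theorem exists_closedLoop_extension (hsys : MemSystemClass t₀ d f T) (hNγ : IsGainPair N γ)
    (hyref : IsSobolevJet r yref) {t₁ : ℝ≥0} (h01 : t₀ ≤ t₁) (X₀ : C(ℝ≥0, State r m))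
    (hinit : ∀ s ∈ Icc 0 (t₀ : ℝ), X₀ s.toNNReal = x₀ s) {K : ℝ≥0}
    (hLip : LipschitzOnWith K (fun t : ℝ => X₀ t.toNNReal) (Icc t₀ t₁))
    (hcon : ∀ t ∈ Icc (t₀ : ℝ) t₁,
      ‖(α / β) • auxError k r (X₀ t.toNNReal - jet r yref t)‖ < 1)
    (heq : ∀ᵐ t ∂(volume.restrict (Icc (t₀ : ℝ) t₁)), HasDerivAt (fun t : ℝ => X₀ t.toNNReal)
      (shiftAppend (X₀ t.toNNReal) (f (d t, T X₀ t,
        controlInput N γ α β k yref (fun t => X₀ t.toNNReal) t))) t) :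
    ∃ ω : ℝ, t₁ < ω ∧ ∃ X : C(ℝ≥0, State r m), (∀ s ≤ t₁, X s = X₀ s) ∧
      IsClosedLoopSolution t₀ d f T x₀ N γ α β k yref ω (fun t => X t.toNNReal) := by
  have h01' : (t₀ : ℝ) ≤ t₁ := h01
  have ht₀ : (0 : ℝ) ≤ t₀ := t₀.2
  -- Freezing the gain beyond radius `κ` gives a right-hand side continuous on the whole space; it
  -- agrees with the true feedback while the norm stays below `κ`, hence for a short time after
  -- `t₁`.
  obtain ⟨κ, hκW, hκ1⟩ := exists_between (hcon t₁ ⟨h01', le_rfl⟩)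
  have hκ0 : 0 ≤ κ := (norm_nonneg _).trans hκW.le
  set cut : Vec m → Vec m := fun e => N (γ (min (‖(α / β) • e‖ ^ 2) (κ ^ 2))) • e with hcut
  have hcutc : Continuous cut := continuous_cutoff_feedback hNγ α β hκ0 hκ1
  let G : (Vec p × State r m) × State r m × Vec q → State r m := fun y =>
    shiftAppend y.2.1 (f (y.1.1, y.2.2, cut (auxErrorCLM r m k r (y.2.1 - y.1.2))))
  have hG : Continuous G := by
    refine continuous_shiftAppend.comp (Continuous.prodMk (by fun_prop) (hsys.continuous.comp ?_))
    refine Continuous.prodMk (by fun_prop) (Continuous.prodMk (by fun_prop) (hcutc.comp ?_))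
    exact (auxErrorCLM r m k r).continuous.comp (by fun_prop)
  -- The reference jet is treated as part of the disturbance.
  have hD : MemLp (fun s => (d s, jet r yref s)) ∞ (volume.restrict (Ici (t₀ : ℝ))) := by
    obtain ⟨C, -, hC⟩ := ae_norm_le_of_memLp_top hsys.disturbance
    obtain ⟨C', -, hC'⟩ := ae_norm_le_of_memLp_top (hyref.memLp_jet t₀)
    refine memLp_top_of_bound (hsys.disturbance.1.prodMk (hyref.memLp_jet t₀).1) (max C C') ?_
    filter_upwards [hC, hC'] with s h h'
    exact max_le_max h h'
  obtain ⟨ε, hε, X, F, M, hX, hFM, hFm, hFG, hXF⟩ := exists_local_solution hsys.operator hG hD h01 X₀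
  have hε' : (0 : ℝ) < ε := hε
  set z : ℝ → State r m := fun t => X t.toNNReal with hz
  have hzc : Continuous z := X.continuous.comp continuous_real_toNNReal
  have hzX₀ : ∀ t : ℝ, t ≤ t₁ → z t = X₀ t.toNNReal := fun t ht =>
    hX _ (Real.toNNReal_le_iff_le_coe.2 ht)
  have hzF : ∀ t ∈ Icc (t₁ : ℝ) (t₁ + ε), z t = X₀ t₁ + ∫ s in (t₁ : ℝ)..t, F s := by
    intro t ht
    have ht0 : 0 ≤ t := t₁.2.trans ht.1
    have := hXF t.toNNReal (NNReal.le_toNNReal_of_coe_le ht.1)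
      (Real.toNNReal_le_iff_le_coe.2 (by exact_mod_cast ht.2))
    rwa [Real.coe_toNNReal _ ht0] at this
  have hWc : ContinuousOn (fun t => ‖(α / β) • auxError k r (z t - jet r yref t)‖) (Ici 0) := by
    have h1 : ContinuousOn (fun t => z t - jet r yref t) (Ici 0) :=
      hzc.continuousOn.sub hyref.continuousOn_jet
    exact (((auxErrorCLM r m k r).continuous.comp_continuousOn h1).const_smul (α / β)).norm
  have hev : {t | ‖(α / β) • auxError k r (z t - jet r yref t)‖ < κ} ∈ 𝓝[≥] (t₁ : ℝ) := by
    refine ((hWc t₁ t₁.2).mono (Ici_subset_Ici.2 t₁.2)).eventually (gt_mem_nhds ?_)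
    simpa only [hz, Real.toNNReal_coe, hX t₁ le_rfl] using hκW
  obtain ⟨u, hu, husub⟩ := mem_nhdsGE_iff_exists_Icc_subset.1 hev
  have hu' : (t₁ : ℝ) < u := hu
  set ω : ℝ := min u (t₁ + ε) with hω
  have hωt : (t₁ : ℝ) < ω := lt_min hu (by linarith)
  have hWκ : ∀ t ∈ Icc (t₁ : ℝ) ω, ‖(α / β) • auxError k r (z t - jet r yref t)‖ < κ :=
    fun t ht => husub ⟨ht.1, ht.2.trans (min_le_left _ _)⟩
  have hlipz : LipschitzOnWith (max K M) z (Icc t₀ (t₁ + ε)) := by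
    refine lipschitzOnWith_Icc_union (b := t₁) ?_ ?_
    · refine LipschitzOnWith.weaken (K := K) (fun s hs t ht => ?_) (le_max_left _ _)
      rw [hzX₀ s hs.2, hzX₀ t ht.2]
      exact hLip hs ht
    · refine LipschitzOnWith.weaken (K := M) (LipschitzOnWith.of_dist_le_mul fun s hs t ht => ?_)
        (le_max_right _ _)
      rw [hzF s hs, hzF t ht, dist_add_left]
      have := (lipschitzWith_primitive hFM hFm).dist_le_mul s t
      rwa [max_eq_right hs.1, max_eq_right ht.1] at this
  have hfeed : ∀ t ∈ Icc (t₁ : ℝ) ω, cut (auxErrorCLM r m k r (z t - jet r yref t)) =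
      controlInput N γ α β k yref z t := by
    intro t ht
    have h1 := hWκ t ht
    simp only [hcut, controlInput, feedback, auxErrorCLM_apply]
    rw [min_eq_left (by gcongr)]
  have hae₁ : ∀ᵐ t : ℝ, t ∈ Icc (t₀ : ℝ) t₁ → t ≠ t₁ → HasDerivAt z (shiftAppend (z t)
      (f (d t, T X t, controlInput N γ α β k yref z t))) t := by
    have hcaus := hsys.operator.causal X X₀ t₁ h01 hX
    rw [ae_restrict_iff' measurableSet_Icc] at heq hcaus
    filter_upwards [heq, hcaus] with t h1 h2 hmem hne
    have hlt : t < t₁ := lt_of_le_of_ne hmem.2 hne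
    rw [h2 hmem, hzX₀ t hmem.2]
    have h3 : controlInput N γ α β k yref z t =
        controlInput N γ α β k yref (fun t => X₀ t.toNNReal) t := by
      simp only [controlInput, hzX₀ t hmem.2]
    rw [h3]
    refine (h1 hmem).congr_of_eventuallyEq ?_
    filter_upwards [Iio_mem_nhds hlt] with s hs using hzX₀ s (le_of_lt hs)
  have hae₂ : ∀ᵐ t : ℝ, t ∈ Icc (t₁ : ℝ) ω → t ≠ t₁ → t ≠ t₁ + ε → HasDerivAt z (shiftAppend (z t)
      (f (d t, T X t, controlInput N γ α β k yref z t))) t := by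
    have hint : IntervalIntegrable F volume t₁ (t₁ + ε) :=
      intervalIntegrable_of_norm_le hFM hFm le_rfl (by linarith)
    rw [ae_restrict_iff' measurableSet_Icc] at hFG
    filter_upwards [hFG, hint.ae_hasDerivAt_integral] with t h1 h2 hmem hne hne'
    have hmem' : t ∈ Icc (t₁ : ℝ) (t₁ + ε) := ⟨hmem.1, hmem.2.trans (min_le_right _ _)⟩
    rw [uIcc_of_le (by linarith)] at h2
    rw [← hfeed t hmem]
    have h3 := (h2 hmem' t₁ ⟨le_rfl, by linarith⟩).const_add (X₀ t₁)
    rw [h1 hmem'] at h3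
    refine h3.congr_of_eventuallyEq ?_
    filter_upwards [Ioo_mem_nhds (lt_of_le_of_ne hmem'.1 hne.symm) (lt_of_le_of_ne hmem'.2 hne')]
      with s hs using hzF s (Ioo_subset_Icc_self hs)
  refine ⟨ω, hωt, X, hX, ?_, ?_⟩
  · intro t ht htω
    have htω' : t < ω := EReal.coe_lt_coe_iff.1 htω
    rcases le_total t t₁ with h | h
    · change ‖(α / β) • auxError k r (z t - jet r yref t)‖ < 1
      rw [hzX₀ t h]
      exact hcon t ⟨ht, h⟩
    · exact (hWκ t ⟨h, htω'.le⟩).trans hκ1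
  · refine ⟨EReal.coe_lt_coe_iff.2 (h01'.trans_lt hωt), ?_, ?_, ?_⟩
    · intro t ht
      rw [← hinit t ht]
      exact hzX₀ t (ht.2.trans h01')
    · intro τ hτ hτω
      have hτω' : τ < ω := EReal.coe_lt_coe_iff.1 hτω
      refine (hlipz.mono ?_).absolutelyContinuousOnInterval
      rw [uIcc_of_le hτ]
      exact Icc_subset_Icc_right (hτω'.le.trans (min_le_right _ _))
    · intro τ hτ hτω
      have hτω' : τ < ω := EReal.coe_lt_coe_iff.1 hτω
      refine ⟨X, fun s _ => by simp, ?_⟩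
      rw [ae_restrict_iff' measurableSet_Icc]
      have hn : ∀ c : ℝ, ∀ᵐ x : ℝ, x ≠ c := fun c => by simp [ae_iff, measure_singleton]
      filter_upwards [hae₁, hae₂, hn t₁, hn (t₁ + ε)] with t h1 h2 h3 h4 hmem
      suffices HasDerivAt z (shiftAppend (z t)
        (f (d t, T X t, controlInput N γ α β k yref z t))) t from hasDerivAt_state_iff.1 this
      rcases le_total t t₁ with h | h
      · exact h1 ⟨hmem.1, h⟩ h3
      · exact h2 ⟨h, hmem.2.trans hτω'.le⟩ h3 h4

end Extension

/-! ### A priori bounds along closed-loop solutions. -/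

section Bounds

variable {m r p q : ℕ} {t₀ : ℝ≥0} {d : ℝ → Vec p}
  {f : Vec p × Vec q × Vec m → Vec m} {T : C(ℝ≥0, State r m) → ℝ → Vec q}
  {x₀ : ℝ → State r m} {N γ : ℝ → ℝ} {α β k : ℝ} {yref : ℕ → ℝ → Vec m} {ω : EReal}
  {x : ℝ → State r m} {u : ℝ → Vec m}

theorem norm_lt_div_of_norm_smul_lt_one {v : Vec m} (hα : 0 < α) (hβ : 0 < β)
    (h : ‖(α / β) • v‖ < 1) : ‖v‖ < β / α := by
  rw [norm_smul, Real.norm_eq_abs, abs_of_pos (div_pos hα hβ), div_mul_eq_mul_div,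
    div_lt_one hβ] at h
  rw [lt_div_iff₀ hα]
  linarith

theorem norm_smul_lt_one_of_norm_lt_div {v : Vec m} (hα : 0 < α) (hβ : 0 < β)
    (h : ‖v‖ < β / α) : ‖(α / β) • v‖ < 1 := by
  rw [norm_smul, Real.norm_eq_abs, abs_of_pos (div_pos hα hβ), div_mul_eq_mul_div, div_lt_one hβ]
  rw [lt_div_iff₀ hα] at h
  linarith

theorem IsSystemSolution.ae_hasDerivAt (h : IsSystemSolution t₀ d f T x₀ u ω x) {τ : ℝ}
    (hτ : (t₀ : ℝ) ≤ τ) (hτω : (τ : EReal) < ω) :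
    ∃ X : C(ℝ≥0, State r m), (∀ s : ℝ≥0, (s : ℝ) ≤ τ → X s = x s) ∧
      ∀ᵐ t ∂(volume.restrict (Icc (t₀ : ℝ) τ)),
        HasDerivAt x (shiftAppend (x t) (f (d t, T X t, u t))) t := by
  obtain ⟨X, hX, hae⟩ := h.equation τ hτ hτω
  refine ⟨X, hX, ?_⟩
  filter_upwards [hae] with t ht using hasDerivAt_state_iff.2 ht

theorem IsSystemSolution.ae_hasDerivAt_error (h : IsSystemSolution t₀ d f T x₀ u ω x)
    (hyref : IsSobolevJet r yref) {τ : ℝ}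
    (hτ : (t₀ : ℝ) ≤ τ) (hτω : (τ : EReal) < ω) :
    ∃ X : C(ℝ≥0, State r m), (∀ s : ℝ≥0, (s : ℝ) ≤ τ → X s = x s) ∧
      ∀ᵐ t ∂(volume.restrict (Icc (t₀ : ℝ) τ)), HasDerivAt (fun t => x t - jet r yref t)
        (shiftAppend (x t - jet r yref t) (f (d t, T X t, u t) - yref r t)) t := by
  obtain ⟨X, hX, hae⟩ := h.ae_hasDerivAt hτ hτω
  refine ⟨X, hX, ?_⟩
  filter_upwards [hae, hyref.ae_hasDerivAt_jet t₀.2 hτ] with t h1 h2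
  rw [← shiftAppend_sub]
  exact h1.sub h2

theorem IsSystemSolution.absolutelyContinuous_error (h : IsSystemSolution t₀ d f T x₀ u ω x)
    (hyref : IsSobolevJet r yref) {τ : ℝ} (hτ : (t₀ : ℝ) ≤ τ) (hτω : (τ : EReal) < ω) :
    AbsolutelyContinuousOnInterval (fun t => x t - jet r yref t) t₀ τ :=
  (h.absolutelyContinuous τ hτ hτω).sub (hyref.absolutelyContinuous_jet t₀.2 hτ)

theorem IsSystemSolution.exists_norm_le (h : IsSystemSolution t₀ d f T x₀ u ω x)
    (hyref : IsSobolevJet r yref) (hx₀ : IsInitialData t₀ x₀) {C : ℝ}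
    (hC : ∀ t : ℝ, (t₀ : ℝ) ≤ t → (t : EReal) < ω → ‖x t - jet r yref t‖ ≤ C) :
    ∃ C' : ℝ, 0 < C' ∧ ∀ t : ℝ, 0 ≤ t → (t : EReal) < ω → ‖x t‖ ≤ C' := by
  obtain ⟨B, hB⟩ := isCompact_Icc.exists_bound_of_continuousOn hx₀.continuousOn
  obtain ⟨R, hR⟩ := hyref.exists_norm_jet_le
  refine ⟨max 1 (max B (C + R)), lt_max_of_lt_left one_pos, fun t ht htω => ?_⟩
  rcases le_total t t₀ with h1 | h1
  · rw [h.initial t ⟨ht, h1⟩]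
    exact (hB t ⟨ht, h1⟩).trans ((le_max_left _ _).trans (le_max_right _ _))
  · refine le_trans ?_ ((le_max_right _ _).trans (le_max_right _ _))
    calc ‖x t‖ = ‖(x t - jet r yref t) + jet r yref t‖ := by rw [sub_add_cancel]
      _ ≤ _ := norm_add_le _ _
      _ ≤ C + R := add_le_add (hC t h1 htω) (hR t ht)

/-- BIBO needs a bound on all of `[0, ∞)`, but `X` is known only up to `τ`. Stopping `X` at `τ`
gives a globally bounded function, and causality leaves `T` unchanged on `[t₀, τ]`. The constant
depends neither on `τ` nor on `X`. -/
theorem IsAdmissibleOperator.exists_ae_norm_le (hT : IsAdmissibleOperator t₀ T) {C : ℝ}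
    (hC0 : 0 < C) (hC : ∀ t : ℝ, 0 ≤ t → (t : EReal) < ω → ‖x t‖ ≤ C) :
    ∃ c : ℝ, 0 < c ∧ ∀ τ : ℝ, (t₀ : ℝ) ≤ τ → (τ : EReal) < ω → ∀ X : C(ℝ≥0, State r m),
      (∀ s : ℝ≥0, (s : ℝ) ≤ τ → X s = x s) →
      ∀ᵐ t ∂(volume.restrict (Icc (t₀ : ℝ) τ)), ‖T X t‖ ≤ c := by
  obtain ⟨c, hc, hbibo⟩ := hT.bibo C hC0
  refine ⟨c, hc, fun τ hτ hτω X hX => ?_⟩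
  have hτ0 : 0 ≤ τ := t₀.2.trans hτ
  let τ' : ℝ≥0 := τ.toNNReal
  have hτ' : (τ' : ℝ) = τ := Real.coe_toNNReal _ hτ0
  let S : C(ℝ≥0, State r m) := X.comp ⟨fun t => min t τ', by fun_prop⟩
  have h1 := hbibo S (fun t => by
    change ‖X (min t τ')‖ ≤ C
    have hle : ((min t τ' : ℝ≥0) : ℝ) ≤ τ := by
      rw [← hτ']; exact_mod_cast min_le_right _ _
    rw [hX _ hle]
    exact hC _ (NNReal.coe_nonneg _) ((EReal.coe_le_coe_iff.2 hle).trans_lt hτω))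
  have h2 := hT.causal X S τ' (NNReal.le_toNNReal_of_coe_le hτ) (fun s hs => by
    change X s = X (min s τ')
    rw [min_eq_left hs])
  rw [hτ'] at h2
  filter_upwards [h2, ae_restrict_of_ae_restrict_of_subset Icc_subset_Ici_self h1] with t h3 h4
  rwa [h3]

/-- All arguments of the continuous right-hand side lie in compact balls, so the derivative is
bounded uniformly up to `ω`. -/
theorem IsSystemSolution.exists_lipschitzOnWith (h : IsSystemSolution t₀ d f T x₀ u ω x)
    (hsys : MemSystemClass t₀ d f T)
    {C : ℝ} (hC : ∀ t : ℝ, 0 ≤ t → (t : EReal) < ω → ‖x t‖ ≤ C) {c : ℝ}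
    (hc : ∀ τ : ℝ, (t₀ : ℝ) ≤ τ → (τ : EReal) < ω → ∀ X : C(ℝ≥0, State r m),
      (∀ s : ℝ≥0, (s : ℝ) ≤ τ → X s = x s) →
      ∀ᵐ t ∂(volume.restrict (Icc (t₀ : ℝ) τ)), ‖T X t‖ ≤ c) {M : ℝ}
    (hM : ∀ t : ℝ, (t₀ : ℝ) ≤ t → (t : EReal) < ω → ‖u t‖ ≤ M) :
    ∃ K : ℝ≥0, LipschitzOnWith K x {t : ℝ | (t₀ : ℝ) ≤ t ∧ (t : EReal) < ω} := by
  obtain ⟨Cd, hCd, hd⟩ := ae_norm_le_of_memLp_top hsys.disturbance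
  have hcont : Continuous fun y : State r m × Vec p × Vec q × Vec m => shiftAppend y.1 (f y.2) :=
    continuous_shiftAppend.comp (continuous_fst.prodMk (hsys.continuous.comp continuous_snd))
  obtain ⟨B, hB⟩ := ((isCompact_closedBall (0 : State r m) C).prod
    ((isCompact_closedBall (0 : Vec p) Cd).prod ((isCompact_closedBall (0 : Vec q) c).prod
      (isCompact_closedBall (0 : Vec m) M)))).exists_bound_of_continuousOn hcont.continuousOn
  have key : ∀ s t : ℝ, (t₀ : ℝ) ≤ s → s ≤ t → (t : EReal) < ω → ‖x t - x s‖ ≤ B * t - B * s := by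
    intro s t hs hst htω
    have ht := hs.trans hst
    obtain ⟨X, hX, hae⟩ := h.ae_hasDerivAt ht htω
    have hsub : Icc s t ⊆ Icc (t₀ : ℝ) t := Icc_subset_Icc_left hs
    refine norm_sub_le_of_ae_norm_deriv_le (B := fun t => B * t) hst
      ((h.absolutelyContinuous t ht htω).mono (by rwa [uIcc_of_le hst, uIcc_of_le ht]))
      (ContDiffOn.absolutelyContinuousOnInterval (by fun_prop)) ?_
    filter_upwards [ae_restrict_of_ae_restrict_of_subset hsub hae,
      ae_restrict_of_ae_restrict_of_subset hsub (hc t ht htω X hX),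
      ae_restrict_of_ae_restrict_of_subset (hsub.trans Icc_subset_Ici_self) hd,
      ae_restrict_mem measurableSet_Icc] with σ h1 h2 h3 h4
    have h5 : (t₀ : ℝ) ≤ σ := hs.trans h4.1
    have h6 : (σ : EReal) < ω := (EReal.coe_le_coe_iff.2 h4.2).trans_lt htω
    refine ⟨_, B, h1, by simpa using (hasDerivAt_id σ).const_mul B, ?_⟩
    exact hB (x σ, d σ, T X σ, u σ) ⟨by simpa using hC σ (t₀.2.trans h5) h6, by simpa using h3,
      by simpa using h2, by simpa using hM σ h5 h6⟩
  refine ⟨B.toNNReal, LipschitzOnWith.of_dist_le_mul ?_⟩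
  have key' : ∀ s t : ℝ, (t₀ : ℝ) ≤ s → s ≤ t → (t : EReal) < ω →
      dist (x s) (x t) ≤ B.toNNReal * dist s t := by
    intro s t hs hst htω
    rw [dist_comm, dist_eq_norm, dist_comm, Real.dist_eq, abs_of_nonneg (by linarith)]
    calc _ ≤ _ := key s t hs hst htω
      _ = B * (t - s) := by ring
      _ ≤ _ := by
        gcongr
        exact Real.le_coe_toNNReal B
  intro s hs t ht
  rcases le_total s t with hst | hst
  · exact key' s t hs.1 hst ht.2
  · rw [dist_comm, dist_comm s]
    exact key' t s ht.1 hst hs.2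

variable [NeZero r]

theorem IsClosedLoopSolution.norm_auxError_one_le
    (h : IsClosedLoopSolution t₀ d f T x₀ N γ α β k yref ω x) (hα : 0 < α) (hβ : 0 < β)
    (hk : 1 ≤ k) (hyref : IsSobolevJet r yref)
    (hξ : ∀ i : ℕ, 2 ≤ i → i ≤ r → ‖auxError k i (x₀ t₀ - jet r yref t₀)‖ < β / α) {t : ℝ}
    (ht : (t₀ : ℝ) ≤ t) (htω : (t : EReal) < ω) :
    (∀ i : ℕ, 2 ≤ i → i ≤ r → ‖auxError k i (x t - jet r yref t)‖ ≤ β / α) ∧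
    (1 < r → ‖auxError k 1 (x t - jet r yref t)‖ ≤
      Real.exp (-(k * (t - t₀))) * ‖auxError k 1 (x₀ t₀ - jet r yref t₀)‖ +
        β / α / k * (1 - Real.exp (-(k * (t - t₀))))) := by
  obtain ⟨X, -, hae⟩ := h.2.ae_hasDerivAt_error hyref ht htω
  have hinit : x t₀ = x₀ t₀ := h.2.initial t₀ ⟨t₀.2, le_rfl⟩
  have hb : 0 < β / α := div_pos hβ hα
  have := norm_auxError_le_of_chain (E := fun t => x t - jet r yref t)
    (w := fun t => f (d t, T X t, controlInput N γ α β k yref x t) - yref r t) hk hb.le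
    (h.2.absolutelyContinuous_error hyref ht htω) hae
    (fun s hs => (norm_lt_div_of_norm_smul_lt_one hα hβ (h.1 s hs.1
      ((EReal.coe_le_coe_iff.2 hs.2).trans_lt htω))).le)
    (fun i h2 hi => by rw [hinit]; exact (hξ i h2 hi).le)
  rw [hinit] at this
  exact ⟨fun i h2 hi => this.1 i h2 hi t ⟨ht, le_rfl⟩, fun hr => this.2 hr t ⟨ht, le_rfl⟩⟩

theorem IsClosedLoopSolution.exists_norm_error_le
    (h : IsClosedLoopSolution t₀ d f T x₀ N γ α β k yref ω x) (hα : 0 < α) (hβ : 0 < β)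
    (hk : 1 ≤ k) (hyref : IsSobolevJet r yref)
    (hξ : ∀ i : ℕ, 2 ≤ i → i ≤ r → ‖auxError k i (x₀ t₀ - jet r yref t₀)‖ < β / α) :
    ∃ C : ℝ, ∀ t : ℝ, (t₀ : ℝ) ≤ t → (t : EReal) < ω → ‖x t - jet r yref t‖ ≤ C := by
  have hb : 0 < β / α := div_pos hβ hα
  set c := max (β / α) ‖auxError k 1 (x₀ t₀ - jet r yref t₀)‖ with hc
  obtain ⟨C, hC⟩ := exists_norm_le_of_auxError_le r m k c
  refine ⟨C, fun t ht htω => hC _ fun i hi => ?_⟩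
  obtain ⟨h1, h2⟩ := h.norm_auxError_one_le hα hβ hk hyref hξ ht htω
  rcases Nat.eq_zero_or_pos i with rfl | hipos
  · rcases Nat.lt_or_ge 1 r with hr | hr
    · refine (h2 hr).trans ?_
      set e := Real.exp (-(k * (t - t₀))) with he
      have he0 : 0 < e := Real.exp_pos _
      have he1 : e ≤ 1 := by
        rw [he, Real.exp_le_one_iff]
        have : 0 ≤ k * (t - t₀) := mul_nonneg (by linarith) (by linarith)
        linarith
      have hck : β / α / k ≤ c := (div_le_self hb.le hk).trans (le_max_left _ _)
      calc _ ≤ e * c + c * (1 - e) := by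
            gcongr
            exact le_max_right _ _
        _ = c := by ring
    · obtain rfl : r = 1 := by omega
      exact (norm_lt_div_of_norm_smul_lt_one hα hβ (h.1 t ht htω)).le.trans (le_max_left _ _)
  · exact (h1 (i + 1) (by omega) (by omega)).trans (le_max_left _ _)

/-- The feedback keeps the control law uniformly away from its singularity. -/
theorem IsClosedLoopSolution.exists_norm_lt
    (h : IsClosedLoopSolution t₀ d f T x₀ N γ α β k yref ω x) (hα : 0 < α) (hβ : 0 < β)
    (hsys : MemSystemClass t₀ d f T) (hNγ : IsGainPair N γ) (hyref : IsSobolevJet r yref)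
    {C : ℝ} (hC : ∀ t : ℝ, (t₀ : ℝ) ≤ t → (t : EReal) < ω → ‖x t - jet r yref t‖ ≤ C) {c : ℝ}
    (hc0 : 0 < c) (hc : ∀ τ : ℝ, (t₀ : ℝ) ≤ τ → (τ : EReal) < ω → ∀ X : C(ℝ≥0, State r m),
      (∀ s : ℝ≥0, (s : ℝ) ≤ τ → X s = x s) →
      ∀ᵐ t ∂(volume.restrict (Icc (t₀ : ℝ) τ)), ‖T X t‖ ≤ c) :
    ∃ κ : ℝ, 0 < κ ∧ κ < 1 ∧ ∀ t : ℝ, (t₀ : ℝ) ≤ t → (t : EReal) < ω →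
      ‖(α / β) • auxError k r (x t - jet r yref t)‖ < κ := by
  obtain ⟨Cd, hCd, hd⟩ := ae_norm_le_of_memLp_top hsys.disturbance
  obtain ⟨Cy, hCy, hy⟩ := ae_norm_le_of_memLp_top (hyref.memLp r le_rfl)
  obtain ⟨Ce, hCe⟩ := (isCompact_closedBall (0 : State r m) C).exists_bound_of_continuousOn
    (f := fun z => auxErrorCLM r m k r (shiftAppend z 0))
    (((auxErrorCLM r m k r).continuous.comp (continuous_shiftAppend.comp
      (continuous_id.prodMk continuous_const))).continuousOn)
  -- `Ce + Cy` bounds everything in `e_r'` apart from `f`, and taking `η` to be the initial norm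
  -- makes the solution start below `κ`.
  obtain ⟨κ, ρ, hηκ, hκ0, hκ1, hρκ, hbar⟩ := exists_gain_barrier hsys.continuous hsys.highGain hNγ
    hα hβ (isCompact_closedBall (0 : Vec p) Cd) (isCompact_closedBall (0 : Vec q) c)
    ⟨0, by simpa using hCd.le⟩ ⟨0, by simpa using hc0.le⟩
    (h.1 t₀ le_rfl h.2.lt) (Ce + Cy)
  refine ⟨κ, hκ0, hκ1, fun τ hτ hτω => ?_⟩
  obtain ⟨X, hX, hae⟩ := h.2.ae_hasDerivAt_error hyref hτ hτω
  set E : ℝ → State r m := fun t => x t - jet r yref t with hE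
  let L : State r m →L[ℝ] Vec m := (α / β) • auxErrorCLM r m k r
  have hL : ∀ z, L z = (α / β) • auxError k r z := fun _ => rfl
  have hAC : AbsolutelyContinuousOnInterval (fun t => ‖L (E t)‖ ^ 2) t₀ τ :=
    absolutelyContinuous_norm_sq (absolutelyContinuous_clm_comp L
      (h.2.absolutelyContinuous_error hyref hτ hτω))
  -- The squared norm is used for its derivative; `ρ` may be negative, so it is replaced by `max ρ
  -- 0` before squaring.
  have key := lt_of_barrier (ρ := max ρ 0 ^ 2) (κ := κ ^ 2) hτ hAC (by
      have h1 : max ρ 0 < κ := max_lt hρκ hκ0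
      have h2 : 0 ≤ max ρ 0 := le_max_right _ _
      gcongr)
    (by rw [hL]; gcongr) (by
      filter_upwards [hae, hc τ hτ hτω X hX,
        ae_restrict_of_ae_restrict_of_subset Icc_subset_Ici_self hd,
        ae_restrict_of_ae_restrict_of_subset (fun t ht => t₀.2.trans ht.1) hy,
        ae_restrict_mem measurableSet_Icc] with t h1 h2 h3 h4 hmem hlow hup
      have hlow' : ρ < ‖L (E t)‖ :=
        (le_max_left _ _).trans_lt (lt_of_pow_lt_pow_left₀ 2 (norm_nonneg _) hlow)
      have hup' : ‖L (E t)‖ ≤ κ := (pow_le_pow_iff_left₀ (norm_nonneg _) hκ0.le two_ne_zero).1 hup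
      refine ⟨_, (L.hasFDerivAt.comp_hasDerivAt t h1).norm_sq, ?_⟩
      have h5 : L (shiftAppend (E t) (f (d t, T X t, controlInput N γ α β k yref x t) - yref r t))
          = (α / β) • (f (d t, T X t, feedback N γ α β (auxError k r (E t))) +
            (auxError k r (shiftAppend (E t) 0) - yref r t)) := by
        rw [hL, auxError_shiftAppend_self, auxError_shiftAppend_self]
        congr 1
        simp only [controlInput, hE]
        abel
      have h6 := hbar (auxError k r (E t)) hlow' hup' (d t) (by simpa using h3) (T X t)
        (by simpa using h2)
      have h7 : ‖auxError k r (shiftAppend (E t) 0)‖ ≤ Ce :=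
        hCe (E t) (by simpa using hC t hmem.1 ((EReal.coe_le_coe_iff.2 hmem.2).trans_lt hτω))
      have h8 : inner ℝ (L (E t)) (auxError k r (shiftAppend (E t) 0) - yref r t) ≤ Ce + Cy := by
        refine (real_inner_le_norm _ _).trans ?_
        calc _ ≤ 1 * ‖auxError k r (shiftAppend (E t) 0) - yref r t‖ := by
              gcongr; linarith
          _ ≤ _ := by
            rw [one_mul]
            exact (norm_sub_le _ _).trans (add_le_add h7 h4)
      rw [h5, inner_smul_right, inner_add_right]
      rw [← hL] at h6
      have hab : 0 < α / β := div_pos hα hβ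
      have : inner ℝ (L (E t)) (f (d t, T X t, feedback N γ α β (auxError k r (E t)))) +
        inner ℝ (L (E t)) (auxError k r (shiftAppend (E t) 0) - yref r t) ≤ 0 := by linarith
      have := mul_nonpos_of_nonneg_of_nonpos hab.le this
      simp only [Function.comp_apply]
      linarith)
  rw [hL] at key
  exact lt_of_pow_lt_pow_left₀ 2 hκ0.le key

theorem exists_norm_feedback_le (hNγ : IsGainPair N γ) (hα : 0 < α) (hβ : 0 < β) {κ : ℝ}
    (hκ1 : κ < 1) :
    ∃ M : ℝ, ∀ e : Vec m, ‖(α / β) • e‖ < κ → ‖feedback N γ α β e‖ ≤ M := by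
  obtain ⟨B, hB⟩ := (isCompact_Icc (a := (0 : ℝ)) (b := max κ 0 ^ 2)).exists_bound_of_continuousOn
    (hNγ.continuousOn_comp.mono fun y hy => ⟨hy.1, hy.2.trans_lt (by
      have h1 : max κ 0 < 1 := max_lt hκ1 one_pos
      have h2 : 0 ≤ max κ 0 := le_max_right _ _
      nlinarith)⟩)
  refine ⟨B * (β / α), fun e he => ?_⟩
  have h1 := hB (‖(α / β) • e‖ ^ 2) ⟨by positivity, by
    have := he.le.trans (le_max_left κ 0)
    gcongr⟩
  have h2 := (norm_lt_div_of_norm_smul_lt_one hα hβ (he.trans hκ1)).le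
  rw [feedback, norm_smul]
  exact mul_le_mul h1 h2 (norm_nonneg _) ((norm_nonneg _).trans h1)

end Bounds

/-! ### Existence, continuation and the funnel comparison. -/

section Global

variable {m r p q : ℕ} [NeZero r] {t₀ : ℝ≥0} {d : ℝ → Vec p}
  {f : Vec p × Vec q × Vec m → Vec m} {T : C(ℝ≥0, State r m) → ℝ → Vec q}
  {x₀ : ℝ → State r m} {N γ : ℝ → ℝ} {α β k : ℝ} {yref : ℕ → ℝ → Vec m}

theorem exists_closedLoopSolution (hsys : MemSystemClass t₀ d f T) (hx₀ : IsInitialData t₀ x₀)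
    (hNγ : IsGainPair N γ) (hyref : IsSobolevJet r yref)
    (hcon : ‖(α / β) • auxError k r (x₀ t₀ - jet r yref t₀)‖ < 1) :
    ∃ (ω : EReal) (x : ℝ → State r m),
      IsClosedLoopSolution t₀ d f T x₀ N γ α β k yref ω x := by
  let X₀ : C(ℝ≥0, State r m) := ⟨fun s => x₀ (min s t₀), by
    refine hx₀.continuousOn.comp_continuous (f := fun s : ℝ≥0 => min (s : ℝ) t₀) (by fun_prop)
      fun s => ⟨?_, min_le_right _ _⟩
    positivity⟩
  have hX₀ : ∀ s ∈ Icc 0 (t₀ : ℝ), X₀ s.toNNReal = x₀ s := by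
    intro s hs
    change x₀ (min (s.toNNReal : ℝ) t₀) = x₀ s
    rw [Real.coe_toNNReal _ hs.1, min_eq_left hs.2]
  -- Restarting at `t₁ = t₀`: the interval already solved is a single point, so the Lipschitz and
  -- equation requirements are trivial.
  obtain ⟨ω, -, X, -, hX⟩ := exists_closedLoop_extension hsys hNγ hyref le_rfl X₀ hX₀ (K := 0)
    (α := α) (β := β) (k := k) (by
      rw [Icc_self]
      exact LipschitzOnWith.of_dist_le_mul (by simp))
    (by
      rintro t ⟨h1, h2⟩
      obtain rfl : t = t₀ := le_antisymm h2 h1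
      rw [hX₀ (t₀ : ℝ) ⟨t₀.coe_nonneg, le_rfl⟩]
      exact hcon)
    (by simp)
  exact ⟨ω, _, hX⟩

/-- A bounded closed-loop solution with finite lifetime `ω` has a proper right extension. -/
theorem IsClosedLoopSolution.exists_extension {ω : ℝ} {x : ℝ → State r m}
    (h : IsClosedLoopSolution t₀ d f T x₀ N γ α β k yref ω x)
    (hsys : MemSystemClass t₀ d f T) (hx₀ : IsInitialData t₀ x₀)
    (hNγ : IsGainPair N γ) (hyref : IsSobolevJet r yref) {κ : ℝ} (hκ : κ < 1)
    (hcon : ∀ t : ℝ, (t₀ : ℝ) ≤ t → (t : EReal) < ω →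
      ‖(α / β) • auxError k r (x t - jet r yref t)‖ < κ) {K : ℝ≥0}
    (hLip : LipschitzOnWith K x {t : ℝ | (t₀ : ℝ) ≤ t ∧ (t : EReal) < (ω : EReal)}) :
    ∃ (ω' : EReal) (x' : ℝ → State r m), (ω : EReal) < ω' ∧
      (∀ t : ℝ, 0 ≤ t → (t : EReal) < ω → x' t = x t) ∧
      IsClosedLoopSolution t₀ d f T x₀ N γ α β k yref ω' x' := by
  have hlt : (t₀ : ℝ) < ω := EReal.coe_lt_coe_iff.1 h.2.lt
  have hω0 : 0 ≤ ω := t₀.2.trans hlt.le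
  -- A Lipschitz extension supplies the limit at `ω`; gluing it to the initial history gives a
  -- continuous function to restart from.
  obtain ⟨g, hg, hgx⟩ := hLip.extend_finite_dimension
  have hgx' : ∀ t : ℝ, (t₀ : ℝ) ≤ t → t < ω → g t = x t := fun t h1 h2 =>
    (hgx ⟨h1, EReal.coe_lt_coe_iff.2 h2⟩).symm
  have hgt₀ : g t₀ = x₀ t₀ := by
    rw [hgx' t₀ le_rfl hlt, h.2.initial t₀ ⟨t₀.2, le_rfl⟩]
  let X₀ : C(ℝ≥0, State r m) := ⟨fun s => x₀ (min s t₀) + (g (max t₀ s) - g t₀), by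
    have h1 : Continuous fun s : ℝ≥0 => x₀ (min (s : ℝ) t₀) := by
      refine hx₀.continuousOn.comp_continuous (f := fun s : ℝ≥0 => min (s : ℝ) t₀) (by fun_prop)
        fun s => ⟨?_, min_le_right _ _⟩
      positivity
    have h2 : Continuous fun s : ℝ≥0 => g (max (t₀ : ℝ) s) := hg.continuous.comp (by fun_prop)
    exact h1.add (h2.sub continuous_const)⟩
  have hXapply : ∀ s : ℝ, 0 ≤ s → X₀ s.toNNReal = x₀ (min s t₀) + (g (max t₀ s) - g t₀) := by
    intro s hs
    change x₀ (min (s.toNNReal : ℝ) t₀) + (g (max (t₀ : ℝ) (s.toNNReal : ℝ)) - g t₀) = _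
    rw [Real.coe_toNNReal _ hs]
  have hX1 : ∀ s ∈ Icc 0 (t₀ : ℝ), X₀ s.toNNReal = x₀ s := by
    intro s hs
    rw [hXapply s hs.1, min_eq_left hs.2, max_eq_left hs.2, sub_self, add_zero]
  have hX2 : ∀ s : ℝ, (t₀ : ℝ) ≤ s → X₀ s.toNNReal = g s := by
    intro s hs
    rw [hXapply s (t₀.2.trans hs), min_eq_right hs, max_eq_right hs, hgt₀, add_sub_cancel]
  have hXx : ∀ s : ℝ, 0 ≤ s → s < ω → X₀ s.toNNReal = x s := by
    intro s h0 hs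
    rcases le_total s t₀ with h1 | h1
    · rw [hX1 s ⟨h0, h1⟩, h.2.initial s ⟨h0, h1⟩]
    · rw [hX2 s h1, hgx' s h1 hs]
  let t₁ : ℝ≥0 := ω.toNNReal
  have ht₁ : (t₁ : ℝ) = ω := Real.coe_toNNReal _ hω0
  have h01 : t₀ ≤ t₁ := NNReal.le_toNNReal_of_coe_le hlt.le
  have hn : ∀ c : ℝ, ∀ᵐ x : ℝ, x ≠ c := fun c => by simp [ae_iff, measure_singleton]
  obtain ⟨ω', hω', X, hX, hsol⟩ := exists_closedLoop_extension (α := α) (β := β) (k := k) hsys hNγ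
    hyref h01 X₀ hX1 (K := lipschitzExtensionConstant (State r m) * K) (by
      intro s hs t ht
      change edist (X₀ s.toNNReal) (X₀ t.toNNReal) ≤ _
      rw [hX2 s hs.1, hX2 t ht.1]
      exact hg s t)
    (by
      rw [ht₁]
      intro t ht
      refine lt_of_le_of_lt ?_ hκ
      rw [hX2 t ht.1]
      have hc : ContinuousOn (fun t => ‖(α / β) • auxErrorCLM r m k r (g t - jet r yref t)‖)
          (Icc (t₀ : ℝ) ω) := by
        have h1 : ContinuousOn (fun t => g t - jet r yref t) (Icc (t₀ : ℝ) ω) :=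
          hg.continuous.continuousOn.sub
            (hyref.continuousOn_jet.mono fun s hs => t₀.2.trans hs.1)
        exact (((auxErrorCLM r m k r).continuous.comp_continuousOn h1).const_smul (α / β)).norm
      have hcl : closure (Ico (t₀ : ℝ) ω) = Icc (t₀ : ℝ) ω := closure_Ico hlt.ne
      rw [← hcl] at hc ht
      -- At `ω` itself only the weak inequality survives, which suffices because `κ < 1`.
      refine le_on_closure (s := Ico (t₀ : ℝ) ω) (fun s hs => ?_) hc continuousOn_const ht
      rw [hgx' s hs.1 hs.2]
      exact (hcon s hs.1 (EReal.coe_lt_coe_iff.2 hs.2)).le)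
    (by
      rw [ht₁, ae_restrict_iff' measurableSet_Icc]
      -- The equation is available only on `[t₀, τ]` with `τ < ω`, with a continuous extension
      -- depending on `τ`. Causality replaces each by `X₀`, and a sequence of `τ` tending to `ω`
      -- exhausts the interval.
      have hτ : ∀ n : ℕ, ∃ τ : ℝ, (t₀ : ℝ) ≤ τ ∧ τ < ω ∧ ω - 1 / (n + 1) ≤ τ := fun n =>
        ⟨max t₀ (ω - 1 / (n + 1)), le_max_left _ _,
          max_lt hlt (by linarith [show (0 : ℝ) < 1 / (n + 1) by positivity]), le_max_right _ _⟩
      choose τ hτ1 hτ2 hτ3 using hτ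
      have hae : ∀ n : ℕ, ∀ᵐ t : ℝ, t ∈ Icc (t₀ : ℝ) (τ n) → HasDerivAt x (shiftAppend (x t)
          (f (d t, T X₀ t, controlInput N γ α β k yref x t))) t := by
        intro n
        obtain ⟨Z, hZ, hZd⟩ := h.2.ae_hasDerivAt (hτ1 n) (EReal.coe_lt_coe_iff.2 (hτ2 n))
        have hτ0 : 0 ≤ τ n := t₀.2.trans (hτ1 n)
        have hcaus := hsys.operator.causal X₀ Z (τ n).toNNReal (NNReal.le_toNNReal_of_coe_le (hτ1 n))
          (fun s hs => by
            have hs' : (s : ℝ) ≤ τ n := by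
              rw [← Real.coe_toNNReal _ hτ0]; exact_mod_cast hs
            rw [hZ s hs', ← hXx s s.2 (hs'.trans_lt (hτ2 n)), Real.toNNReal_coe])
        rw [Real.coe_toNNReal _ hτ0, ae_restrict_iff' measurableSet_Icc] at hcaus
        rw [ae_restrict_iff' measurableSet_Icc] at hZd
        filter_upwards [hcaus, hZd] with t h1 h2 hmem
        rw [h1 hmem]
        exact h2 hmem
      filter_upwards [ae_all_iff.2 hae, hn t₀, hn ω] with t h1 h2 h3 hmem
      have ht0 : (t₀ : ℝ) < t := lt_of_le_of_ne hmem.1 h2.symm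
      have htω : t < ω := lt_of_le_of_ne hmem.2 h3
      have hXt := hXx t (t₀.2.trans ht0.le) htω
      obtain ⟨n, hn⟩ := exists_nat_one_div_lt (sub_pos.2 htω)
      have h4 := h1 n ⟨hmem.1, by linarith [hτ3 n]⟩
      have h5 : controlInput N γ α β k yref (fun t => X₀ t.toNNReal) t =
          controlInput N γ α β k yref x t := by
        simp only [controlInput, hXt]
      rw [h5, hXt]
      refine h4.congr_of_eventuallyEq ?_
      filter_upwards [Ioo_mem_nhds ht0 htω] with s hs
        using hXx s (t₀.2.trans hs.1.le) hs.2)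
  rw [ht₁] at hω'
  refine ⟨ω', _, EReal.coe_lt_coe_iff.2 hω', fun t ht htω => ?_, hsol⟩
  have htω' : t < ω := EReal.coe_lt_coe_iff.1 htω
  rw [← hXx t ht htω']
  exact hX _ (Real.toNNReal_le_toNNReal htω'.le)

/-- With `e = exp(-k s)`: `v ≤ b + e (v₀ - b) < b + e (w₀ - b) ≤ b + exp(-α s) (w₀ - b) ≤ w`. The
first step needs `k ≥ 1`, the third `k ≥ α` and `b ≤ w₀`. -/
theorem norm_lt_of_exp_bounds {α k b v v₀ w w₀ s : ℝ} (hs : 0 ≤ s) (hαk : α ≤ k) (hk : 1 ≤ k)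
    (hb : 0 ≤ b) (hbw : b ≤ w₀) (h₀ : v₀ < w₀)
    (hv : v ≤ Real.exp (-(k * s)) * v₀ + b / k * (1 - Real.exp (-(k * s))))
    (hw : Real.exp (-(α * s)) * (w₀ - b) ≤ w - b) : v < w := by
  have he0 : 0 < Real.exp (-(k * s)) := Real.exp_pos _
  have he1 : Real.exp (-(k * s)) ≤ 1 := by
    rw [Real.exp_le_one_iff]
    have : 0 ≤ k * s := mul_nonneg (by linarith) hs
    linarith
  have he2 : Real.exp (-(k * s)) ≤ Real.exp (-(α * s)) := by
    rw [Real.exp_le_exp]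
    have : α * s ≤ k * s := by gcongr
    linarith
  have hbk : b / k ≤ b := div_le_self hb hk
  have h1 : Real.exp (-(k * s)) * (w₀ - b) ≤ Real.exp (-(α * s)) * (w₀ - b) :=
    mul_le_mul_of_nonneg_right he2 (by linarith)
  have h2 : b / k * (1 - Real.exp (-(k * s))) ≤ b * (1 - Real.exp (-(k * s))) :=
    mul_le_mul_of_nonneg_right hbk (by linarith)
  have h3 : Real.exp (-(k * s)) * v₀ < Real.exp (-(k * s)) * w₀ :=
    mul_lt_mul_of_pos_left h₀ he0
  linarith

end Global

end FunnelControl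

end

/-! ### The main theorem. -/

theorem theorem1 {m r p q : ℕ} [NeZero m] [NeZero r] (t₀ : ℝ≥0)
    (d : ℝ → FunnelControl.Vec p)
    (f : FunnelControl.Vec p × FunnelControl.Vec q × FunnelControl.Vec m → FunnelControl.Vec m)
    (T : C(ℝ≥0, FunnelControl.State r m) → ℝ → FunnelControl.Vec q)
    (hsys : FunnelControl.MemSystemClass t₀ d f T)
    (x₀ : ℝ → FunnelControl.State r m) (hx₀ : FunnelControl.IsInitialData t₀ x₀)
    (α β : ℝ) (ψ : ℝ → ℝ) (hψ : FunnelControl.IsFunnel α β ψ)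
    (k : ℝ) (hk : α + 2 ≤ k)
    (N γ : ℝ → ℝ) (hNγ : FunnelControl.IsGainPair N γ)
    (yref : ℕ → ℝ → FunnelControl.Vec m) (hyref : FunnelControl.IsSobolevJet r yref)
    (hξ₁ : ‖FunnelControl.auxError k 1 (x₀ t₀ - FunnelControl.jet r yref t₀)‖ < ψ t₀)
    (hξ : ∀ i : ℕ, 2 ≤ i → i ≤ r →
      ‖FunnelControl.auxError k i (x₀ t₀ - FunnelControl.jet r yref t₀)‖ < β / α)
    (hr₁ : r = 1 →
      ‖FunnelControl.auxError k 1 (x₀ t₀ - FunnelControl.jet r yref t₀)‖ < β / α) :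
    (∃ (ω : EReal) (x : ℝ → FunnelControl.State r m),
      FunnelControl.IsClosedLoopSolution t₀ d f T x₀ N γ α β k yref ω x) ∧
    ∀ (ω : EReal) (x : ℝ → FunnelControl.State r m),
      FunnelControl.IsMaximalClosedLoopSolution t₀ d f T x₀ N γ α β k yref ω x →
        ω = ⊤ ∧
        (∃ M : ℝ, ∀ t : ℝ, (t₀ : ℝ) ≤ t →
          ‖FunnelControl.controlInput N γ α β k yref x t‖ ≤ M) ∧
        (β / α ≤ ψ t₀ → ∀ t : ℝ, (t₀ : ℝ) ≤ t → ‖x t 0 - yref 0 t‖ < ψ t) := by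
  obtain ⟨hα, hβ, -, -⟩ := id hψ
  have hb : 0 < β / α := div_pos hβ hα
  have hk1 : 1 ≤ k := by linarith
  -- Both cases `r ≥ 2` and `r = 1` say that `e_r` starts where the control law is defined.
  have hr0 : ‖FunnelControl.auxError k r (x₀ t₀ - FunnelControl.jet r yref t₀)‖ < β / α := by
    rcases Nat.lt_or_ge 1 r with hr | hr
    · exact hξ r hr le_rfl
    · have hr1 : r = 1 := le_antisymm hr (Nat.one_le_iff_ne_zero.2 (NeZero.ne r))
      have := hr₁ hr1
      rwa [← congrArg (fun i => ‖FunnelControl.auxError k i (x₀ t₀ - FunnelControl.jet r yref t₀)‖) hr1] at this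
  refine ⟨FunnelControl.exists_closedLoopSolution hsys hx₀ hNγ hyref
    (FunnelControl.norm_smul_lt_one_of_norm_lt_div hα hβ hr0), ?_⟩
  rintro ω x ⟨hsol, hmax⟩
  obtain ⟨C, hC⟩ := hsol.exists_norm_error_le hα hβ hk1 hyref hξ
  obtain ⟨C', hC'0, hC'⟩ := hsol.2.exists_norm_le hyref hx₀ hC
  obtain ⟨c, hc0, hc⟩ := hsys.operator.exists_ae_norm_le hC'0 hC'
  obtain ⟨κ, -, hκ1, hκ⟩ := hsol.exists_norm_lt hα hβ hsys hNγ hyref hC hc0 hc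
  obtain ⟨M, hM⟩ := FunnelControl.exists_norm_feedback_le (m := m) hNγ hα hβ hκ1
  have hu : ∀ t : ℝ, (t₀ : ℝ) ≤ t → (t : EReal) < ω →
      ‖FunnelControl.controlInput N γ α β k yref x t‖ ≤ M := fun t ht htω => hM _ (hκ t ht htω)
  have hω : ω = ⊤ := by
    obtain ⟨K, hK⟩ := hsol.2.exists_lipschitzOnWith hsys hC' hc hu
    induction ω with
    | bot => exact absurd hsol.2.lt (by simp)
    | top => rfl
    | coe ω => exact absurd (hsol.exists_extension hsys hx₀ hNγ hyref hκ1 hκ hK) hmax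
  subst hω
  refine ⟨rfl, ⟨M, fun t ht => hu t ht (EReal.coe_lt_top t)⟩, fun hψb t ht => ?_⟩
  have hψt := hψ.exp_mul_le (a := (t₀ : ℝ)) t₀.coe_nonneg ht
  have hfirst : x t 0 - yref 0 t = FunnelControl.auxError k 1 (x t - FunnelControl.jet r yref t) := by
    simp [FunnelControl.auxError, FunnelControl.jet]
  rw [hfirst]
  rcases Nat.lt_or_ge 1 r with hr | hr
  · exact FunnelControl.norm_lt_of_exp_bounds (sub_nonneg.2 ht) (by linarith) hk1 hb.le hψb hξ₁
      ((hsol.norm_auxError_one_le hα hβ hk1 hyref hξ ht (EReal.coe_lt_top t)).2 hr) hψt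
  -- Here `e_r` is the error itself, so it stays below `β/α`, and `ψ` never drops below `β/α` once
  -- it starts there.
  · have hr1 : r = 1 := le_antisymm hr (Nat.one_le_iff_ne_zero.2 (NeZero.ne r))
    have h1 := FunnelControl.norm_lt_div_of_norm_smul_lt_one hα hβ (hsol.1 t ht (EReal.coe_lt_top t))
    rw [congrArg (fun i => ‖FunnelControl.auxError k i (x t - FunnelControl.jet r yref t)‖) hr1] at h1
    have h2 : 0 ≤ Real.exp (-(α * (t - t₀))) * (ψ t₀ - β / α) :=
      mul_nonneg (Real.exp_pos _).le (by linarith)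
    linarith
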